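/- Let $F$ be a field of characteristic zero. A Borcherds matrix is a square matrix $A=(a_{ij})_{1\le i,j\le l}$ with entries in an ordered field $K$ (for instance $K=\mathbb R$ or $\mathbb Q$) such that (i) $a_{ii}=2$ or $a_{ii}\le 0$; (ii) $a_{ij}\le 0$ for $i\ne j$; (iii) $a_{ij}\in\mathbb Z$ for all $j$ if $a_{ii}=2$; (iv) $a_{ij}=0$ implies $a_{ji}=0$. Suppose that $F$ is an extension field of $K$, and let $H$ be an $F$-vector space with linearly independent coroots $h_1,\dots,h_l\in H$ and roots $\alpha_1,\dots,\alpha_l\in H^*$ such that $\alpha_j(h_i)=a_{ij}$ (the roots may, but need not, be linearly independent). Let $\tilde{\mathfrak g}$ be the Lie algebra over $F$ generated by the vector space $H$ and elements $e_1,\dots,e_l,f_1,\dots,f_l$ with the relations $$[h,h']=0,\quad [h,e_i]=\alpha_i(h)e_i,\quad [h,f_i]=-\alpha_i(h)f_i,\quad [e_i,f_j]=\delta_{ij}h_i\qquad(h,h'\in H).$$ It is graded by the free abelian group on symbols $\alpha_1,\dots,\alpha_l$, with $\deg H=0$, $\deg e_i=\alpha_i$, $\deg f_i=-\alpha_i$.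 A Borcherds Lie algebra of rank $l$ is a quotient $\mathfrak g=\tilde{\mathfrak g}/\tau$, where $\tau$ is either the largest graded ideal of $\tilde{\mathfrak g}$ that meets $H$ trivially, or the ideal generated by the Serre elements $(\mathrm{ad}\,e_i)^{1-a_{ij}}e_j$, $(\mathrm{ad}\,f_i)^{1-a_{ij}}f_j$ ($i\ne j$, $a_{ii}=2$) and $[e_i,e_j]$, $[f_i,f_j]$ ($a_{ij}=0$). It is a Kac–Moody Lie algebra if all $a_{ii}=2$. Let $\mathfrak h$ be the image of $H$ in $\mathfrak g$, let $\mathfrak g_+$ and $\mathfrak g_-$ be the subalgebras of $\mathfrak g$ generated by the $e_i$ and by the $f_i$, respectively, and let $\mathfrak h''$ be any complement of $\mathfrak h\cap[\mathfrak g,\mathfrak g]$ in $\mathfrak h$. For a subalgebra $S$ of a Lie algebra $L$, regard the universal enveloping algebra $U(S)$ as a subalgebra of $U(L)$; a product of such subalgebras is the linear span of the products of their elements. A pair $(P,M)$ of subalgebras of a Lie algebra $L$ is a plus-minus pair of $L$ if $P+M\ne L$ and $U(L)=U(P)U(M)U(P)$. It is regular if moreover $P\cap M=0$ and there is an automorphism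 $\sigma$ of $L$ of order two with $\sigma(P)=M$. **Corollary 3.2.** Let $\mathfrak g$ be a Borcherds Lie algebra of finite rank $l\ge 0$. Then $$U(\mathfrak g)=U(\mathfrak g_+)\,U(\mathfrak g_-)\,U(\mathfrak h'')\,U(\mathfrak g_+)=U(\mathfrak g_-)\,U(\mathfrak g_+)\,U(\mathfrak h'')\,U(\mathfrak g_-).$$ If moreover $l\ge 1$ and $\mathfrak g$ is perfect, that is, $[\mathfrak g,\mathfrak g]=\mathfrak g$, then $P=\mathfrak h''\oplus\mathfrak g_+$ is a subalgebra and $(P,M)$ with $M=\mathfrak g_-$ is a regular plus-minus pair of $\mathfrak g$. Here $\sigma$ can be taken to be the Chevalley involution, the automorphism with $e_i\mapsto -f_i$, $f_i\mapsto -e_i$ and $h\mapsto -h$ for $h\in\mathfrak h$. In particular, this applies to perfect Kac–Moody Lie algebras of finite rank $l\ge1$. -/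

import Mathlib

/-! ### Plus-minus pairs -/

section PlusMinus

variable {F L : Type*} [Field F] [LieRing L] [LieAlgebra F L]

attribute [local instance 100] LieRing.ofAssociativeRing

/-- For a Lie subalgebra `S` of `L`, the image of `U(S)` in `U(L)` under the algebra map induced by
the inclusion `S → L`. Products of such subspaces below are products of submodules, that is, linear
spans of products of elements. -/
noncomputable def LieSubalgebra.env (S : LieSubalgebra F L) :
    Submodule F (UniversalEnvelopingAlgebra F L) :=
  Subalgebra.toSubmodule
    (UniversalEnvelopingAlgebra.lift F ((UniversalEnvelopingAlgebra.ι F).comp S.incl)).range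

/-- `(P, M)` is a plus-minus pair of `L`: `P + M ≠ L` and `U(L) = U(P) U(M) U(P)`. -/
structure IsPlusMinusPair (P M : LieSubalgebra F L) : Prop where
  add_ne : P.toSubmodule ⊔ M.toSubmodule ≠ ⊤
  factorization : P.env * M.env * P.env = ⊤

/-- A plus-minus pair `(P, M)` is regular if `P ∩ M = 0` and some automorphism of `L` of order two
maps `P` onto `M`. -/
structure IsRegularPlusMinusPair (P M : LieSubalgebra F L) : Prop extends
    IsPlusMinusPair P M where
  inf_eq_bot : P ⊓ M = ⊥
  exists_aut : ∃ σ : L ≃ₗ⁅F⁆ L, (∀ x, σ (σ x) = x) ∧ (∃ x, σ x ≠ x) ∧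
    P.map (σ : L →ₗ⁅F⁆ L) = M

end PlusMinus

/-! ### Borcherds matrices and their Lie algebras -/

/-- A Borcherds matrix (generalized generalized Cartan matrix) over an ordered field `K`. -/
structure IsBorcherdsMatrix {ι K : Type*} [Field K] [LinearOrder K] (A : Matrix ι ι K) :
    Prop where
  diag : ∀ i, A i i = 2 ∨ A i i ≤ 0
  off_diag : ∀ i j, i ≠ j → A i j ≤ 0
  integral : ∀ i j, A i i = 2 → ∃ n : ℤ, A i j = n
  zero_symm : ∀ i j, A i j = 0 → A j i = 0

/-- A generalized Cartan matrix, with entries regarded as elements of `K`. -/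
structure IsGeneralizedCartanMatrix {ι K : Type*} [Field K] [LinearOrder K] (A : Matrix ι ι K) :
    Prop where
  diag : ∀ i, A i i = 2
  off_diag : ∀ i j, i ≠ j → A i j ≤ 0
  integral : ∀ i j, ∃ n : ℤ, A i j = n
  zero_symm : ∀ i j, A i j = 0 → A j i = 0

/-- Kac-Moody Lie algebras are the Borcherds Lie algebras of generalized Cartan matrices. -/
theorem IsGeneralizedCartanMatrix.isBorcherdsMatrix {ι K : Type*} [Field K] [LinearOrder K]
    {A : Matrix ι ι K} (hA : IsGeneralizedCartanMatrix A) : IsBorcherdsMatrix A :=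
  ⟨fun i => Or.inl (hA.diag i), hA.off_diag, fun i j _ => hA.integral i j, hA.zero_symm⟩

/-- Cartan data for the matrix `A` over the field `F`: a vector space `H` over `F`, linearly
independent simple coroots `hᵢ` in `H` and simple roots `αᵢ` in the dual of `H`, with
`αⱼ(hᵢ) = aᵢⱼ`. When the simple roots are linearly independent too, this is a realization of `A`.
Independence of the simple roots is not required, so that, for instance, `H` may be spanned by the
coroots; this gives the derived Kac-Moody algebras. -/
structure CartanData {ι K : Type*} [Field K] (A : Matrix ι ι K)
    (F H : Type*) [Field F] [Algebra K F] [AddCommGroup H] [Module F H] where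
  coroot : ι → H
  root : ι → Module.Dual F H
  root_coroot : ∀ i j, root j (coroot i) = algebraMap K F (A i j)
  coroot_indep : LinearIndependent F coroot

noncomputable section

namespace CartanData

/-- Symbols for the generators `h ∈ H`, `eᵢ`, `fᵢ`. -/
inductive Gen (ι H : Type*)
  | h : H → Gen ι H
  | e : ι → Gen ι H
  | f : ι → Gen ι H

variable {ι K : Type*} [Field K] {A : Matrix ι ι K} {F H : Type*} [Field F] [Algebra K F]
  [AddCommGroup H] [Module F H] (D : CartanData A F H)

/-- The generator of the free Lie algebra with a given symbol. -/
abbrev sym (_ : CartanData A F H) (a : Gen ι H) : FreeLieAlgebra F (Gen ι H) :=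
  FreeLieAlgebra.of F a

/-- Elements of the free Lie algebra that are set to zero in `g̃`. The first two kinds make
`H → g̃` linear. -/
inductive Rel : FreeLieAlgebra F (Gen ι H) → Prop
  | add (x y : H) : Rel (D.sym (Gen.h (x + y)) -
      (D.sym (Gen.h x) + D.sym (Gen.h y)))
  | smul (c : F) (x : H) : Rel (D.sym (Gen.h (c • x)) -
      c • D.sym (Gen.h x))
  | hh (x y : H) : Rel ⁅D.sym (Gen.h x), D.sym (Gen.h y)⁆
  | he (x : H) (i : ι) : Rel (⁅D.sym (Gen.h x), D.sym (Gen.e i)⁆ -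
      D.root i x • D.sym (Gen.e i))
  | hf (x : H) (i : ι) : Rel (⁅D.sym (Gen.h x), D.sym (Gen.f i)⁆ +
      D.root i x • D.sym (Gen.f i))
  | ef_same (i : ι) : Rel (⁅D.sym (Gen.e i), D.sym (Gen.f i)⁆ -
      D.sym (Gen.h (D.coroot i)))
  | ef_ne (i j : ι) (hij : i ≠ j) :
      Rel ⁅D.sym (Gen.e i), D.sym (Gen.f j)⁆

/-- The Lie algebra `g̃`: generators `H`, `eᵢ`, `fᵢ`, relations `[h, h'] = 0`,
`[h, eᵢ] = αᵢ(h) eᵢ`, `[h, fᵢ] = -αᵢ(h) fᵢ`, `[eᵢ, fⱼ] = δᵢⱼ hᵢ`. -/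
abbrev Pre : Type _ :=
  FreeLieAlgebra F (Gen ι H) ⧸
    LieSubmodule.lieSpan F (FreeLieAlgebra F (Gen ι H)) {x | D.Rel x}

/-- The image of a generator in `g̃`. -/
def gen (a : Gen ι H) : D.Pre := LieSubmodule.Quotient.mk (D.sym a)

/-- `D.IsMonomial β x`: `x` is an iterated bracket of generators in `g̃`, of degree `β` for the
grading by the root lattice `⨁ ℤ αᵢ` (free on the symbols `αᵢ`) in which elements of `H`, `eᵢ`
and `fᵢ` have degree `0`, `αᵢ` and `-αᵢ`. -/
inductive IsMonomial : (ι →₀ ℤ) → D.Pre → Prop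
  | h (x : H) : IsMonomial 0 (D.gen (Gen.h x))
  | e (i : ι) : IsMonomial (Finsupp.single i 1) (D.gen (Gen.e i))
  | f (i : ι) : IsMonomial (Finsupp.single i (-1)) (D.gen (Gen.f i))
  | lie {β γ : ι →₀ ℤ} {x y : D.Pre} (hx : IsMonomial β x) (hy : IsMonomial γ y) :
      IsMonomial (β + γ) ⁅x, y⁆

/-- The homogeneous component of `g̃` of degree `β`. -/
def piece (β : ι →₀ ℤ) : Submodule F D.Pre := Submodule.span F {x | D.IsMonomial β x}

/-- An ideal of `g̃` is graded if it is spanned by its homogeneous elements. When the simple roots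
are linearly independent, every ideal is graded. -/
def IsGradedIdeal (I : LieIdeal F D.Pre) : Prop :=
  I.toSubmodule ≤ ⨆ β : ι →₀ ℤ, I.toSubmodule ⊓ D.piece β

/-- The largest graded ideal of `g̃` that meets the image of `H` trivially (the sum of all such
ideals). -/
def radical : LieIdeal F D.Pre :=
  sSup {I | D.IsGradedIdeal I ∧ ∀ x : H, D.gen (Gen.h x) ∈ I → D.gen (Gen.h x) = 0}

/-- The Serre elements of `g̃`: `(ad eᵢ)^{1 - aᵢⱼ} eⱼ` and `(ad fᵢ)^{1 - aᵢⱼ} fⱼ` for `i ≠ j` with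
`aᵢᵢ = 2`, and `[eᵢ, eⱼ]` and `[fᵢ, fⱼ]` whenever `aᵢⱼ = 0`. -/
inductive SerreRel : D.Pre → Prop
  | e (i j : ι) (n : ℕ) (hij : i ≠ j) (hi : A i i = 2) (hn : A i j = -(n : K)) :
      SerreRel (((LieAlgebra.ad F D.Pre (D.gen (Gen.e i))) ^ (n + 1)) (D.gen (Gen.e j)))
  | f (i j : ι) (n : ℕ) (hij : i ≠ j) (hi : A i i = 2) (hn : A i j = -(n : K)) :
      SerreRel (((LieAlgebra.ad F D.Pre (D.gen (Gen.f i))) ^ (n + 1)) (D.gen (Gen.f j)))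
  | ee (i j : ι) (hij : A i j = 0) : SerreRel ⁅D.gen (Gen.e i), D.gen (Gen.e j)⁆
  | ff (i j : ι) (hij : A i j = 0) : SerreRel ⁅D.gen (Gen.f i), D.gen (Gen.f j)⁆

/-- The ideal of `g̃` generated by the Serre elements. -/
def serreIdeal : LieIdeal F D.Pre := LieSubmodule.lieSpan F D.Pre {x | D.SerreRel x}

/-- Two definitions of Borcherds (and of Kac-Moody) Lie algebras as quotients of `g̃` are in use:
by the largest graded ideal that meets `H` trivially, and by the Serre relations. Both are
allowed. -/
def IsDefiningIdeal (τ : LieIdeal F D.Pre) : Prop := τ = D.radical ∨ τ = D.serreIdeal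

variable (τ : LieIdeal F D.Pre)

/-- The quotient `g = g̃ / τ`. For a Borcherds matrix and a defining ideal `τ` this is a Borcherds
Lie algebra, of rank the number of indices. -/
abbrev Alg : Type _ := D.Pre ⧸ τ

/-- The Chevalley generator `eᵢ` of `g`. -/
def e (i : ι) : D.Alg τ := LieSubmodule.Quotient.mk (D.gen (Gen.e i))

/-- The Chevalley generator `fᵢ` of `g`. -/
def f (i : ι) : D.Alg τ := LieSubmodule.Quotient.mk (D.gen (Gen.f i))

/-- The image in `g` of an element of `H`. -/
def h (x : H) : D.Alg τ := LieSubmodule.Quotient.mk (D.gen (Gen.h x))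

/-- The standard Cartan subalgebra `𝔥` of `g`: the subalgebra generated by the image of `H`
(which is just that image, as `H → g` is linear and the image is abelian). -/
def cartan : LieSubalgebra F (D.Alg τ) := LieSubalgebra.lieSpan F _ (Set.range (D.h τ))

/-- `g₊`, generated by the `eᵢ`. -/
def plus : LieSubalgebra F (D.Alg τ) := LieSubalgebra.lieSpan F _ (Set.range (D.e τ))

/-- `g₋`, generated by the `fᵢ`. -/
def minus : LieSubalgebra F (D.Alg τ) := LieSubalgebra.lieSpan F _ (Set.range (D.f τ))

/-- The derived subalgebra `g' = [g, g]`. -/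
def derived : LieIdeal F (D.Alg τ) := ⁅(⊤ : LieIdeal F (D.Alg τ)), (⊤ : LieIdeal F (D.Alg τ))⁆

/-- `h''` is a complement of `𝔥' = 𝔥 ∩ g'` in `𝔥`. -/
structure IsComplement (h'' : LieSubalgebra F (D.Alg τ)) : Prop where
  inf_eq_bot : h''.toSubmodule ⊓ ((D.cartan τ).toSubmodule ⊓ (D.derived τ).toSubmodule) = ⊥
  sup_eq : h''.toSubmodule ⊔ ((D.cartan τ).toSubmodule ⊓ (D.derived τ).toSubmodule) =
    (D.cartan τ).toSubmodule

/-- `ω` is the Chevalley involution: `eᵢ ↦ -fᵢ`, `fᵢ ↦ -eᵢ`, and `h ↦ -h` on `𝔥`. -/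
structure IsChevalleyInvolution (ω : D.Alg τ ≃ₗ⁅F⁆ D.Alg τ) : Prop where
  map_e : ∀ i, ω (D.e τ i) = -D.f τ i
  map_f : ∀ i, ω (D.f τ i) = -D.e τ i
  map_h : ∀ x, ω (D.h τ x) = -D.h τ x

end CartanData

end

/-!
Write `U₊`, `U₋` and `U₀` for the enveloping algebras of `g₊`, `g₋` and `h''`. The factorization
`U(g) = U₊ U₋ U₀ U₊` uses only the defining relations of `g̃`, and is proved in any associative
algebra generated by elements that satisfy them (`CartanData.Triple.product_eq_top`). By the
triangular decomposition (`lower_mul_torus_mul_upper`) it suffices that `U₋ p` lies in the product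
for every polynomial `p` in the coroots with coefficients in `U₀`. This goes by induction on the
degree of `p`. For `y ∈ U₋`, the commutator `[eᵢ, y]` is congruent to `∂ᵢ(y) hᵢ` modulo `U₋`, where
`∂ᵢ` is the derivation with `fⱼ ↦ δᵢⱼ`. Since `eᵢ y p` and `y eᵢ p = (y p') eᵢ` lie in the product,
so does `∂ᵢ(y) hᵢ p`. In characteristic zero every element of `U₋` is of the form `∂ᵢ(y)`, by
integration by parts (`lower_le_derivs`); hence `U₋ hᵢ p` lies in the product
(`lower_mul_polys_mem_product`). The second factorization follows by exchanging the `eᵢ` with the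
`fᵢ` and changing the sign of `H`.

It remains to see that `h''` and the coroots span `𝔥`, and that `g₊`, `𝔥` and `g₋` are independent
in `g`. Both rest on the grading by height. As the simple roots may be dependent, it is not read off
from weights, but from the eigenvalues `2ⁿ` of the endomorphism with `eᵢ ↦ 2 eᵢ`, `fᵢ ↦ fᵢ / 2`,
`h ↦ h`. Both choices of `τ` are stable under it and have no part of height zero
(`IsDefiningIdeal.scaling_mem`, `IsDefiningIdeal.le_grOn`). For the radical, this holds because
the degree zero component of `g̃` is `H` (`exists_eq_h_of_mem_piece_zero`); for the Serre ideal,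
because the Serre elements in the `fᵢ` are killed by all `ad eᵢ` (`Triple.IsSerre.e_lie`), so that
they generate an ideal inside the lower half. As `H` embeds into `g̃`, by its action on Verma modules
(`gen_h_eq_zero`), it embeds into `g`. Linear forms on `H` that vanish on the coroots extend to
homomorphisms from `g` to the abelian Lie algebra `F`, so `𝔥 ∩ [g, g]` is spanned by coroots
(`mem_span_coroot_of_h_mem_derived`).

If `g` is perfect, then `h'' = 0`. The coroots are nonzero elements of height zero, so they are not
in `g₊ + g₋`, and they are not fixed by the Chevalley involution, which exists on `g` because
both choices of `τ` are stable under exchanging the `eᵢ` with the `fᵢ`.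
-/

noncomputable section

/-! ### Preliminaries on Lie algebras -/

section LieAlgebra

variable {F L : Type*} [CommRing F] [LieRing L] [LieAlgebra F L]

variable (F) in
theorem LieAlgebra.lie_mem_of_mem_span {s : Set L} {N : Submodule F L} {a y : L}
    (h : ∀ x ∈ s, ⁅a, x⁆ ∈ N) (hy : y ∈ Submodule.span F s) : ⁅a, y⁆ ∈ N := by
  have : Submodule.span F s ≤ N.comap (LieAlgebra.ad F L a : L →ₗ[F] L) := Submodule.span_le.2 h
  exact this hy

theorem LieAlgebra.lie_mem_sup {N₁ N₂ : Submodule F L} {a n : L} (h₁ : ∀ x ∈ N₁, ⁅a, x⁆ ∈ N₁)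
    (h₂ : ∀ x ∈ N₂, ⁅a, x⁆ ∈ N₂) (hn : n ∈ N₁ ⊔ N₂) : ⁅a, n⁆ ∈ N₁ ⊔ N₂ := by
  obtain ⟨x, hx, y, hy, rfl⟩ := Submodule.mem_sup.1 hn
  rw [lie_add]
  exact Submodule.add_mem_sup (h₁ x hx) (h₂ y hy)

theorem LieAlgebra.ad_smul_pow_smul (c d : F) (a b : L) (n : ℕ) :
    (LieAlgebra.ad F L (c • a) ^ n) (d • b) = (c ^ n * d) • (LieAlgebra.ad F L a ^ n) b := by
  rw [map_smul (LieAlgebra.ad F L), smul_pow, LinearMap.smul_apply, LinearMap.map_smul, smul_smul]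

theorem LieHom.map_ad_pow {L' : Type*} [LieRing L'] [LieAlgebra F L'] (φ : L →ₗ⁅F⁆ L') (a b : L)
    (n : ℕ) : φ ((LieAlgebra.ad F L a ^ n) b) = (LieAlgebra.ad F L' (φ a) ^ n) (φ b) := by
  induction n with
  | zero => simp
  | succ n ih => rw [pow_succ', pow_succ', Module.End.mul_apply, Module.End.mul_apply, ← ih,
      LieAlgebra.ad_apply, LieAlgebra.ad_apply, LieHom.map_lie]

end LieAlgebra

section Quotient

variable {F L L' : Type*} [CommRing F] [LieRing L] [LieAlgebra F L] [LieRing L'] [LieAlgebra F L']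

/-- The Lie algebra homomorphism on `L ⧸ I` induced by one on `L` that vanishes on `I`. -/
def LieIdeal.quotientLift (I : LieIdeal F L) (φ : L →ₗ⁅F⁆ L') (hφ : ∀ x ∈ I, φ x = 0) :
    L ⧸ I →ₗ⁅F⁆ L' :=
  { I.toSubmodule.liftQ (φ : L →ₗ[F] L') hφ with
    map_lie' := by
      intro x y
      obtain ⟨x, rfl⟩ := Submodule.Quotient.mk_surjective _ x
      obtain ⟨y, rfl⟩ := Submodule.Quotient.mk_surjective _ y
      exact φ.map_lie x y }

/-- The projection `L → L ⧸ I` as a homomorphism of Lie algebras. -/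
def LieIdeal.proj (I : LieIdeal F L) : L →ₗ⁅F⁆ L ⧸ I :=
  { I.toSubmodule.mkQ with map_lie' := rfl }

theorem LieIdeal.proj_surjective (I : LieIdeal F L) : Function.Surjective I.proj :=
  Submodule.Quotient.mk_surjective _

theorem LieIdeal.proj_eq_zero (I : LieIdeal F L) {x : L} : I.proj x = 0 ↔ x ∈ I :=
  Submodule.Quotient.mk_eq_zero I.toSubmodule

end Quotient

/-! ### The universal property of `g̃` -/

namespace CartanData

variable {ι K : Type*} [Field K] {A : Matrix ι ι K} {F H : Type*} [Field F] [Algebra K F]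
  [AddCommGroup H] [Module F H] (D : CartanData A F H)

/-- A family of elements of a Lie algebra `L`, indexed linearly by `H` and by the `eᵢ` and `fᵢ`,
that satisfies the defining relations of `g̃`. -/
structure Triple (L : Type*) [LieRing L] [LieAlgebra F L] where
  h : H →ₗ[F] L
  e : ι → L
  f : ι → L
  hh : ∀ x y, ⁅h x, h y⁆ = 0
  he : ∀ x i, ⁅h x, e i⁆ = D.root i x • e i
  hf : ∀ x i, ⁅h x, f i⁆ = -(D.root i x • f i)
  ef_same : ∀ i, ⁅e i, f i⁆ = h (D.coroot i)
  ef_ne : ∀ i j, i ≠ j → ⁅e i, f j⁆ = 0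

namespace Triple

variable {D} {L L' : Type*} [LieRing L] [LieAlgebra F L] [LieRing L'] [LieAlgebra F L']

/-- The image of a triple under a homomorphism. -/
@[simps]
def map (T : D.Triple L) (φ : L →ₗ⁅F⁆ L') : D.Triple L' where
  h := (φ : L →ₗ[F] L') ∘ₗ T.h
  e i := φ (T.e i)
  f i := φ (T.f i)
  hh x y := by simp [← LieHom.map_lie, T.hh]
  he x i := by simp [← LieHom.map_lie, T.he]
  hf x i := by simp [← LieHom.map_lie, T.hf]
  ef_same i := by simp [← LieHom.map_lie, T.ef_same]
  ef_ne i j hij := by simp [← LieHom.map_lie, T.ef_ne i j hij]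

/-- The triple `(-h, f, e)`, which exchanges the two halves of `g̃`. -/
@[simps]
def swap (T : D.Triple L) : D.Triple L where
  h := -T.h
  e := T.f
  f := T.e
  hh x y := by simp [T.hh]
  he x i := by simp [T.hf]
  hf x i := by simp [T.he]
  ef_same i := by rw [← lie_skew, T.ef_same]; rfl
  ef_ne i j hij := by rw [← lie_skew, T.ef_ne j i hij.symm, neg_zero]

/-- The triple `(h, c e, c⁻¹ f)`. -/
@[simps]
def scale (T : D.Triple L) (c : F) (hc : c ≠ 0) : D.Triple L where
  h := T.h
  e i := c • T.e i
  f i := c⁻¹ • T.f i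
  hh := T.hh
  he x i := by rw [lie_smul, T.he, smul_comm]
  hf x i := by rw [lie_smul, T.hf, smul_neg, smul_comm]
  ef_same i := by simp [T.ef_same, smul_smul, hc]
  ef_ne i j hij := by simp [T.ef_ne i j hij]

/-- The homomorphism on the free Lie algebra determined by a triple. -/
def freeLift (T : D.Triple L) : FreeLieAlgebra F (Gen ι H) →ₗ⁅F⁆ L :=
  FreeLieAlgebra.lift F fun a => match a with
    | Gen.h x => T.h x
    | Gen.e i => T.e i
    | Gen.f i => T.f i

@[simp] theorem freeLift_h (T : D.Triple L) (x : H) : T.freeLift (D.sym (Gen.h x)) = T.h x :=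
  FreeLieAlgebra.lift_of_apply _ _

@[simp] theorem freeLift_e (T : D.Triple L) (i : ι) : T.freeLift (D.sym (Gen.e i)) = T.e i :=
  FreeLieAlgebra.lift_of_apply _ _

@[simp] theorem freeLift_f (T : D.Triple L) (i : ι) : T.freeLift (D.sym (Gen.f i)) = T.f i :=
  FreeLieAlgebra.lift_of_apply _ _

theorem freeLift_eq_zero (T : D.Triple L) {x : FreeLieAlgebra F (Gen ι H)} (hx : D.Rel x) :
    T.freeLift x = 0 := by
  cases hx with
  | add x y => rw [map_sub, map_add]; simp
  | smul c x => rw [map_sub, map_smul]; simp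
  | hh x y => rw [LieHom.map_lie]; simp [T.hh]
  | he x i => rw [map_sub, LieHom.map_lie, map_smul]; simp [T.he]
  | hf x i => rw [map_add, LieHom.map_lie, map_smul]; simp [T.hf]
  | ef_same i => rw [map_sub, LieHom.map_lie]; simp [T.ef_same]
  | ef_ne i j hij => rw [LieHom.map_lie]; simp [T.ef_ne i j hij]

/-- The homomorphism `g̃ → L` determined by a triple in `L`. -/
def lift (T : D.Triple L) : D.Pre →ₗ⁅F⁆ L :=
  LieIdeal.quotientLift _ T.freeLift (by
    have : LieSubmodule.lieSpan F (FreeLieAlgebra F (Gen ι H)) {x | D.Rel x} ≤ T.freeLift.ker :=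
      LieSubmodule.lieSpan_le.2 fun x hx => (LieHom.mem_ker).2 (T.freeLift_eq_zero hx)
    exact fun x hx => (LieHom.mem_ker).1 (this hx))

@[simp] theorem lift_h (T : D.Triple L) (x : H) : T.lift (D.gen (Gen.h x)) = T.h x :=
  T.freeLift_h x

@[simp] theorem lift_e (T : D.Triple L) (i : ι) : T.lift (D.gen (Gen.e i)) = T.e i :=
  T.freeLift_e i

@[simp] theorem lift_f (T : D.Triple L) (i : ι) : T.lift (D.gen (Gen.f i)) = T.f i :=
  T.freeLift_f i

end Triple

variable {L : Type*} [LieRing L] [LieAlgebra F L]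

theorem gen_eq_zero {x : FreeLieAlgebra F (Gen ι H)} (hx : D.Rel x) :
    (LieIdeal.proj (LieSubmodule.lieSpan F (FreeLieAlgebra F (Gen ι H)) {x | D.Rel x})) x = 0 :=
  (LieIdeal.proj_eq_zero _).2 (LieSubmodule.subset_lieSpan hx)

/-- The generators of `g̃`. -/
@[simps]
def preTriple : D.Triple D.Pre where
  h :=
    { toFun := fun x => D.gen (Gen.h x)
      map_add' := fun x y => sub_eq_zero.1 (D.gen_eq_zero (Rel.add x y))
      map_smul' := fun c x => sub_eq_zero.1 (D.gen_eq_zero (Rel.smul c x)) }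
  e i := D.gen (Gen.e i)
  f i := D.gen (Gen.f i)
  hh x y := D.gen_eq_zero (Rel.hh x y)
  he x i := sub_eq_zero.1 (D.gen_eq_zero (Rel.he x i))
  hf x i := eq_neg_of_add_eq_zero_left (D.gen_eq_zero (Rel.hf x i))
  ef_same i := sub_eq_zero.1 (D.gen_eq_zero (Rel.ef_same i))
  ef_ne i j hij := D.gen_eq_zero (Rel.ef_ne i j hij)

variable {D} in
theorem pre_hom_ext {φ ψ : D.Pre →ₗ⁅F⁆ L} (hh : ∀ x, φ (D.gen (Gen.h x)) = ψ (D.gen (Gen.h x)))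
    (he : ∀ i, φ (D.gen (Gen.e i)) = ψ (D.gen (Gen.e i)))
    (hf : ∀ i, φ (D.gen (Gen.f i)) = ψ (D.gen (Gen.f i))) : φ = ψ := by
  have : φ.comp (LieIdeal.proj _) = ψ.comp (LieIdeal.proj _) := by
    refine FreeLieAlgebra.hom_ext fun a => ?_
    cases a with
    | h x => exact hh x
    | e i => exact he i
    | f i => exact hf i
  ext x
  obtain ⟨x, rfl⟩ := LieIdeal.proj_surjective _ x
  exact LieHom.congr_fun this x

/-- The algebra `g̃` is generated by `H`, the `eᵢ` and the `fᵢ`. -/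
theorem pre_generated (S : LieSubalgebra F D.Pre) (hh : ∀ x, D.gen (Gen.h x) ∈ S)
    (he : ∀ i, D.gen (Gen.e i) ∈ S) (hf : ∀ i, D.gen (Gen.f i) ∈ S) (x : D.Pre) : x ∈ S := by
  let T : D.Triple S :=
    { h := D.preTriple.h.codRestrict S.toSubmodule hh
      e := fun i => ⟨_, he i⟩
      f := fun i => ⟨_, hf i⟩
      hh := fun x y => Subtype.ext (D.preTriple.hh x y)
      he := fun x i => Subtype.ext (D.preTriple.he x i)
      hf := fun x i => Subtype.ext (D.preTriple.hf x i)
      ef_same := fun i => Subtype.ext (D.preTriple.ef_same i)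
      ef_ne := fun i j hij => Subtype.ext (D.preTriple.ef_ne i j hij) }
  have key : S.incl.comp T.lift = LieHom.id := by
    apply pre_hom_ext <;> intro x <;> rw [LieHom.comp_apply] <;> simp [T]
    rfl
  have := LieHom.congr_fun key x
  rw [LieHom.comp_apply, LieHom.id_apply] at this
  rw [← this]
  exact (T.lift x).2

end CartanData

/-! ### Factorization of an associative algebra generated by a triple -/

/-- A subspace that contains `1` and is stable under left multiplication by `s` contains the
subalgebra generated by `s`. -/
theorem Submodule.adjoin_le_of_mul_mem {F R : Type*} [CommRing F] [Ring R] [Algebra F R]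
    (N : Submodule F R) (s : Set R) (h1 : 1 ∈ N) (hs : ∀ a ∈ s, ∀ n ∈ N, a * n ∈ N) :
    Subalgebra.toSubmodule (Algebra.adjoin F s) ≤ N := by
  intro a ha
  suffices ∀ n ∈ N, a * n ∈ N by simpa using this 1 h1
  induction ha using Algebra.adjoin_induction with
  | mem a ha => exact hs a ha
  | algebraMap c => intro n hn; rw [← Algebra.smul_def]; exact N.smul_mem c hn
  | add a b _ _ iha ihb => intro n hn; rw [add_mul]; exact N.add_mem (iha n hn) (ihb n hn)
  | mul a b _ _ iha ihb => intro n hn; rw [mul_assoc]; exact iha _ (ihb n hn)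

namespace CartanData.Triple

attribute [local instance 100] LieRing.ofAssociativeRing

variable {ι K : Type*} [Field K] {A : Matrix ι ι K} {F H : Type*} [Field F] [Algebra K F]
  [AddCommGroup H] [Module F H] {D : CartanData A F H}
  {R : Type*} [Ring R] [Algebra F R] (T : D.Triple R)

theorem h_mul_h (x y : H) : T.h x * T.h y = T.h y * T.h x := by
  have := T.hh x y
  rwa [LieRing.of_associative_ring_bracket, sub_eq_zero] at this

theorem e_mul_h (x : H) (i : ι) : T.e i * T.h x = (T.h x - algebraMap F R (D.root i x)) * T.e i := by
  have := T.he x i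
  rw [LieRing.of_associative_ring_bracket] at this
  rw [sub_mul, ← Algebra.smul_def, ← this]
  abel

theorem h_mul_f (x : H) (i : ι) : T.h x * T.f i = T.f i * T.h x - D.root i x • T.f i := by
  have := T.hf x i
  rw [LieRing.of_associative_ring_bracket] at this
  rw [sub_eq_iff_eq_add.1 this]
  abel

theorem e_mul_f_same (i : ι) : T.e i * T.f i = T.f i * T.e i + T.h (D.coroot i) := by
  have := T.ef_same i
  rw [LieRing.of_associative_ring_bracket] at this
  rw [sub_eq_iff_eq_add.1 this]
  abel

theorem e_mul_f_ne (i j : ι) (hij : i ≠ j) : T.e i * T.f j = T.f j * T.e i := by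
  have := T.ef_ne i j hij
  rwa [LieRing.of_associative_ring_bracket, sub_eq_zero] at this

/-- The unital associative subalgebra generated by the `fᵢ`. -/
def lower : Subalgebra F R := Algebra.adjoin F (Set.range T.f)

/-- The unital associative subalgebra generated by the `eᵢ`. -/
def upper : Subalgebra F R := Algebra.adjoin F (Set.range T.e)

/-- The unital associative subalgebra generated by the image of a subset of `H`. -/
def torus (X : Set H) : Subalgebra F R := Algebra.adjoin F (T.h '' X)

theorem f_mem_lower (i : ι) : T.f i ∈ T.lower := Algebra.subset_adjoin ⟨i, rfl⟩

theorem e_mem_upper (i : ι) : T.e i ∈ T.upper := Algebra.subset_adjoin ⟨i, rfl⟩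

theorem h_mem_torus {X : Set H} {x : H} (hx : x ∈ X) : T.h x ∈ T.torus X :=
  Algebra.subset_adjoin ⟨x, hx, rfl⟩

theorem e_mul_torus (i : ι) {X : Set H} {p : R} (hp : p ∈ T.torus X) :
    ∃ q ∈ T.torus X, T.e i * p = q * T.e i := by
  induction hp using Algebra.adjoin_induction with
  | mem a ha =>
    obtain ⟨y, hy, rfl⟩ := ha
    exact ⟨_, sub_mem (T.h_mem_torus hy) (Subalgebra.algebraMap_mem _ _), T.e_mul_h y i⟩
  | algebraMap c =>
    exact ⟨_, Subalgebra.algebraMap_mem _ c, (Algebra.commutes c _).symm⟩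
  | add a b _ _ iha ihb =>
    obtain ⟨a', ha', ha⟩ := iha
    obtain ⟨b', hb', hb⟩ := ihb
    exact ⟨_, add_mem ha' hb', by rw [mul_add, add_mul, ha, hb]⟩
  | mul a b _ _ iha ihb =>
    obtain ⟨a', ha', ha⟩ := iha
    obtain ⟨b', hb', hb⟩ := ihb
    exact ⟨_, mul_mem ha' hb', by rw [← mul_assoc, ha, mul_assoc, hb, mul_assoc]⟩

theorem h_mul_lower (x : H) {y : R} (hy : y ∈ T.lower) : T.h x * y - y * T.h x ∈ T.lower := by
  induction hy using Algebra.adjoin_induction with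
  | mem a ha =>
    obtain ⟨i, rfl⟩ := ha
    rw [T.h_mul_f, sub_sub_cancel_left]
    exact neg_mem (Subalgebra.smul_mem _ (T.f_mem_lower i) _)
  | algebraMap c => rw [← Algebra.commutes, sub_self]; exact zero_mem _
  | add a b _ _ iha ihb =>
    convert add_mem iha ihb using 1
    noncomm_ring
  | mul a b ha hb iha ihb =>
    convert add_mem (mul_mem iha hb) (mul_mem ha ihb) using 1
    noncomm_ring

/-- `z` is a derivative of `y` in the direction `i`: both lie in the lower subalgebra and
`[eᵢ, y] ≡ z hᵢ` modulo that subalgebra. For words in the `fⱼ` this is the derivation with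
`fⱼ ↦ δᵢⱼ`, but `z` need not be determined by `y` when the `fⱼ` satisfy relations. -/
structure IsDeriv (i : ι) (y z : R) : Prop where
  left_mem : y ∈ T.lower
  right_mem : z ∈ T.lower
  sub_mem : T.e i * y - y * T.e i - z * T.h (D.coroot i) ∈ T.lower

variable {T}

theorem IsDeriv.add {i : ι} {y z y' z' : R} (h : T.IsDeriv i y z) (h' : T.IsDeriv i y' z') :
    T.IsDeriv i (y + y') (z + z') := by
  refine ⟨add_mem h.1 h'.1, add_mem h.2 h'.2, ?_⟩
  convert add_mem h.3 h'.3 using 1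
  noncomm_ring

theorem IsDeriv.smul {i : ι} {y z : R} (c : F) (h : T.IsDeriv i y z) :
    T.IsDeriv i (c • y) (c • z) := by
  refine ⟨Subalgebra.smul_mem _ h.1 c, Subalgebra.smul_mem _ h.2 c, ?_⟩
  convert Subalgebra.smul_mem _ h.3 c using 1
  rw [mul_smul_comm, smul_mul_assoc, smul_mul_assoc, smul_sub, smul_sub]

theorem IsDeriv.mul {i : ι} {y z y' z' : R} (h : T.IsDeriv i y z) (h' : T.IsDeriv i y' z') :
    T.IsDeriv i (y * y') (z * y' + y * z') := by
  refine ⟨mul_mem h.1 h'.1, add_mem (mul_mem h.2 h'.1) (mul_mem h.1 h'.2), ?_⟩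
  convert add_mem (add_mem (mul_mem h.3 h'.1) (mul_mem h.1 h'.3))
    (mul_mem h.2 (T.h_mul_lower (D.coroot i) h'.1)) using 1
  noncomm_ring

variable (T)

theorem isDeriv_algebraMap (i : ι) (c : F) : T.IsDeriv i (algebraMap F R c) 0 :=
  ⟨Subalgebra.algebraMap_mem _ c, zero_mem _, by simp [Algebra.commutes c (T.e i)]⟩

theorem isDeriv_f_same (i : ι) : T.IsDeriv i (T.f i) 1 :=
  ⟨T.f_mem_lower i, one_mem _, by simp [T.e_mul_f_same]⟩

theorem isDeriv_f_ne {i j : ι} (hij : i ≠ j) : T.IsDeriv i (T.f j) 0 :=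
  ⟨T.f_mem_lower j, zero_mem _, by simp [T.e_mul_f_ne i j hij]⟩

theorem exists_isDeriv (i : ι) {y : R} (hy : y ∈ T.lower) : ∃ z, T.IsDeriv i y z := by
  induction hy using Algebra.adjoin_induction with
  | mem a ha =>
    obtain ⟨j, rfl⟩ := ha
    by_cases hij : i = j
    · subst hij; exact ⟨_, T.isDeriv_f_same i⟩
    · exact ⟨_, T.isDeriv_f_ne hij⟩
  | algebraMap c => exact ⟨_, T.isDeriv_algebraMap i c⟩
  | add a b _ _ iha ihb => exact ⟨_, iha.choose_spec.add ihb.choose_spec⟩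
  | mul a b _ _ iha ihb => exact ⟨_, iha.choose_spec.mul ihb.choose_spec⟩

theorem isDeriv_f_pow (i : ι) (n : ℕ) :
    T.IsDeriv i (T.f i ^ (n + 1)) (((n : F) + 1) • T.f i ^ n) := by
  induction n with
  | zero => simpa using T.isDeriv_f_same i
  | succ n ih =>
    have key := ih.mul (T.isDeriv_f_same i)
    rw [smul_mul_assoc, ← pow_succ, ← pow_succ, mul_one] at key
    rwa [Nat.cast_succ, add_smul _ (1 : F), one_smul]

/-- The word in the `fᵢ` with a given list of indices. -/
def word (w : List ι) : R := (w.map T.f).prod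

theorem word_cons (j : ι) (w : List ι) : T.word (j :: w) = T.f j * T.word w := by
  simp [word]

theorem lower_le_span_word :
    Subalgebra.toSubmodule T.lower ≤ Submodule.span F (Set.range T.word) := by
  apply Submodule.adjoin_le_of_mul_mem
  · exact Submodule.subset_span ⟨[], by simp [word]⟩
  · rintro _ ⟨j, rfl⟩ n hn
    induction hn using Submodule.span_induction with
    | mem x hx =>
      obtain ⟨w, rfl⟩ := hx
      exact Submodule.subset_span ⟨j :: w, T.word_cons j w⟩
    | zero => simp
    | add x y _ _ hx hy => rw [mul_add]; exact add_mem hx hy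
    | smul c x _ hx => rw [mul_smul_comm]; exact Submodule.smul_mem _ c hx

/-- The span of the words of length less than `n`. -/
def shortWords (n : ℕ) : Submodule F R := Submodule.span F (T.word '' {w | w.length < n})

theorem f_mul_shortWords (j : ι) {n : ℕ} {z : R} (hz : z ∈ T.shortWords n) :
    T.f j * z ∈ T.shortWords (n + 1) := by
  induction hz using Submodule.span_induction with
  | mem x hx =>
    obtain ⟨w, hw, rfl⟩ := hx
    refine Submodule.subset_span ⟨j :: w, ?_, T.word_cons j w⟩
    simpa using hw
  | zero => simp
  | add x y _ _ hx hy => rw [mul_add]; exact add_mem hx hy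
  | smul c x _ hx => rw [mul_smul_comm]; exact Submodule.smul_mem _ c hx

/-- Differentiation shortens words. -/
theorem exists_isDeriv_word (i : ι) (w : List ι) :
    ∃ z ∈ T.shortWords w.length, T.IsDeriv i (T.word w) z := by
  induction w with
  | nil => exact ⟨0, zero_mem _, by simpa [word] using T.isDeriv_algebraMap i 1⟩
  | cons j w ih =>
    obtain ⟨z, hz, hd⟩ := ih
    have hz' := T.f_mul_shortWords j hz
    by_cases hij : i = j
    · subst hij
      refine ⟨_, ?_, T.word_cons i w ▸ (T.isDeriv_f_same i).mul hd⟩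
      refine add_mem ?_ hz'
      rw [one_mul]
      exact Submodule.subset_span ⟨w, by simp, rfl⟩
    · refine ⟨_, ?_, T.word_cons j w ▸ (T.isDeriv_f_ne hij).mul hd⟩
      rwa [zero_mul, zero_add]

/-- The elements that are derivatives in the direction `i`. -/
def derivs (i : ι) : Submodule F R where
  carrier := {z | ∃ y, T.IsDeriv i y z}
  add_mem' := fun ⟨_, h⟩ ⟨_, h'⟩ => ⟨_, h.add h'⟩
  zero_mem' := ⟨_, T.isDeriv_algebraMap i 0⟩
  smul_mem' := fun c _ ⟨_, h⟩ => ⟨_, h.smul c⟩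

/-- Integration by parts: up to a shorter word, `fᵢⁿ w` is the derivative of
`fᵢⁿ⁺¹ w / (n + 1)`. -/
theorem f_pow_mul_word_mem_derivs [CharZero F] (i : ι) (N : ℕ) :
    ∀ w : List ι, w.length < N → ∀ n : ℕ, T.f i ^ n * T.word w ∈ T.derivs i := by
  induction N with
  | zero => intro w hw; omega
  | succ N ih =>
    intro w hw n
    obtain ⟨z, hz, hd⟩ := T.exists_isDeriv_word i w
    have h1 := (T.isDeriv_f_pow i n).mul hd
    have h2 : T.f i ^ (n + 1) * z ∈ T.derivs i := by
      clear h1 hd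
      induction hz using Submodule.span_induction with
      | mem x hx =>
        obtain ⟨u, hu, rfl⟩ := hx
        exact ih u (by simp only [Set.mem_ofPred_eq] at hu; omega) (n + 1)
      | zero => simp
      | add x y _ _ hx hy => rw [mul_add]; exact add_mem hx hy
      | smul c x _ hx => rw [mul_smul_comm]; exact Submodule.smul_mem _ c hx
    have h3 : ((n : F) + 1) • T.f i ^ n * T.word w ∈ T.derivs i := by
      have h4 : _ ∈ T.derivs i := ⟨_, h1⟩
      simpa using sub_mem h4 h2
    rw [smul_mul_assoc] at h3
    exact (Submodule.smul_mem_iff _ (Nat.cast_add_one_ne_zero n)).1 h3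

/-- In characteristic zero every element of the lower subalgebra is a derivative. -/
theorem lower_le_derivs [CharZero F] (i : ι) :
    Subalgebra.toSubmodule T.lower ≤ T.derivs i := by
  refine T.lower_le_span_word.trans (Submodule.span_le.2 ?_)
  rintro _ ⟨w, rfl⟩
  simpa using T.f_pow_mul_word_mem_derivs i _ w (Nat.lt_succ_self _) 0

/-- The polynomials of degree at most `k` in the `hᵢ` with coefficients in the subalgebra generated
by the image of `X`. -/
def polys (X : Set H) : ℕ → Submodule F R
  | 0 => Subalgebra.toSubmodule (T.torus X)
  | k + 1 => polys X k ⊔ ⨆ i, (polys X k).map (LinearMap.mulLeft F (T.h (D.coroot i)))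

theorem polys_le_succ (X : Set H) (k : ℕ) : T.polys X k ≤ T.polys X (k + 1) := le_sup_left

theorem polys_mono (X : Set H) : Monotone (T.polys X) :=
  monotone_nat_of_le_succ (T.polys_le_succ X)

theorem coroot_mul_polys (X : Set H) (k : ℕ) (i : ι) {p : R} (hp : p ∈ T.polys X k) :
    T.h (D.coroot i) * p ∈ T.polys X (k + 1) :=
  le_sup_right (a := T.polys X k) (Submodule.mem_iSup_of_mem i ⟨p, hp, rfl⟩)

theorem polys_succ_induction {X : Set H} {k : ℕ} {motive : R → Prop}
    (poly : ∀ p ∈ T.polys X k, motive p)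
    (mul : ∀ i, ∀ p ∈ T.polys X k, motive (T.h (D.coroot i) * p))
    (add : ∀ p q, motive p → motive q → motive (p + q)) {p : R} (hp : p ∈ T.polys X (k + 1)) :
    motive p := by
  obtain ⟨a, ha, b, hb, rfl⟩ := Submodule.mem_sup.1 hp
  refine add _ _ (poly a ha) ?_
  clear hp
  induction hb using Submodule.iSup_induction' with
  | mem i x hx => obtain ⟨q, hq, rfl⟩ := hx; exact mul i q hq
  | zero => exact poly 0 (zero_mem _)
  | add x y _ _ hx hy => exact add _ _ hx hy

theorem e_mul_polys (X : Set H) (i : ι) (k : ℕ) :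
    ∀ p ∈ T.polys X k, ∃ q ∈ T.polys X k, T.e i * p = q * T.e i := by
  induction k with
  | zero => exact fun p hp => T.e_mul_torus i hp
  | succ k ih =>
    intro p hp
    refine T.polys_succ_induction
      (motive := fun p => ∃ q ∈ T.polys X (k + 1), T.e i * p = q * T.e i) ?_ ?_ ?_ hp
    · intro p hp
      obtain ⟨q, hq, h⟩ := ih p hp
      exact ⟨q, T.polys_le_succ X k hq, h⟩
    · intro j p hp
      obtain ⟨q, hq, h⟩ := ih p hp
      refine ⟨T.h (D.coroot j) * q - D.root i (D.coroot j) • q,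
        sub_mem (T.coroot_mul_polys X k j hq)
          (Submodule.smul_mem _ _ (T.polys_le_succ X k hq)), ?_⟩
      rw [← mul_assoc, T.e_mul_h, mul_assoc, h, sub_mul, sub_mul, ← mul_assoc, ← mul_assoc,
        Algebra.smul_def]
    · rintro p q ⟨p', hp', hp⟩ ⟨q', hq', hq⟩
      exact ⟨_, add_mem hp' hq', by rw [mul_add, add_mul, hp, hq]⟩

theorem h_mul_polys {X : Set H} {x : H} (hx : x ∈ X) (k : ℕ) :
    ∀ p ∈ T.polys X k, T.h x * p ∈ T.polys X k := by
  induction k with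
  | zero => exact fun p hp => (T.torus X).mul_mem (T.h_mem_torus hx) hp
  | succ k ih =>
    intro p hp
    refine T.polys_succ_induction (motive := fun p => T.h x * p ∈ T.polys X (k + 1)) ?_ ?_ ?_ hp
    · exact fun p hp => T.polys_le_succ X k (ih p hp)
    · intro j p hp
      rw [← mul_assoc, T.h_mul_h, mul_assoc]
      exact T.coroot_mul_polys X k j (ih p hp)
    · exact fun p q hp hq => by rw [mul_add]; exact add_mem hp hq

theorem torus_le_iSup_polys {X : Set H}
    (hX : Submodule.span F X ⊔ Submodule.span F (Set.range D.coroot) = ⊤) :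
    Subalgebra.toSubmodule (T.torus Set.univ) ≤ ⨆ k, T.polys X k := by
  have hdir := (T.polys_mono X).directed_le
  apply Submodule.adjoin_le_of_mul_mem
  · exact Submodule.mem_iSup_of_mem 0 (one_mem (T.torus X))
  · rintro _ ⟨x, -, rfl⟩ p hp
    obtain ⟨k, hk⟩ := (Submodule.mem_iSup_of_directed _ hdir).1 hp
    have hx : x ∈ Submodule.span F (X ∪ Set.range D.coroot) := by
      rw [Submodule.span_union, hX]; trivial
    induction hx using Submodule.span_induction with
    | mem x hx =>
      rcases hx with hx | ⟨i, rfl⟩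
      · exact Submodule.mem_iSup_of_mem k (T.h_mul_polys hx k p hk)
      · exact Submodule.mem_iSup_of_mem (k + 1) (T.coroot_mul_polys X k i hk)
    | zero => simp
    | add x y _ _ hx hy => rw [map_add, add_mul]; exact add_mem hx hy
    | smul c x _ hx => rw [map_smul, smul_mul_assoc]; exact Submodule.smul_mem _ c hx

/-- The subspace `U₊ U₋ U(X) U₊`. -/
def product (X : Set H) : Submodule F R :=
  Subalgebra.toSubmodule T.upper * Subalgebra.toSubmodule T.lower *
    Subalgebra.toSubmodule (T.torus X) * Subalgebra.toSubmodule T.upper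

theorem mul_upper_mem_product {X : Set H} {a r : R} (ha : a ∈ T.product X) (hr : r ∈ T.upper) :
    a * r ∈ T.product X := by
  have := Submodule.mul_mem_mul ha (show r ∈ Subalgebra.toSubmodule T.upper from hr)
  rwa [product, mul_assoc _ _ (Subalgebra.toSubmodule T.upper),
    (Subalgebra.isIdempotentElem_toSubmodule T.upper).eq] at this

theorem upper_mul_mem_product {X : Set H} {a r : R} (ha : a ∈ T.product X) (hr : r ∈ T.upper) :
    r * a ∈ T.product X := by
  have := Submodule.mul_mem_mul (show r ∈ Subalgebra.toSubmodule T.upper from hr) ha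
  rwa [product, ← mul_assoc, ← mul_assoc, ← mul_assoc,
    (Subalgebra.isIdempotentElem_toSubmodule T.upper).eq] at this

/-- The step that absorbs the coroots: if `y hᵢ = [eᵢ, y'] - m`, then
`y hᵢ p = eᵢ (y' p) - (y' p') eᵢ - m p` with `eᵢ p = p' eᵢ`, which lowers the degree in the `hᵢ` by one. -/
theorem lower_mul_polys_mem_product [CharZero F] (X : Set H) (k : ℕ) :
    ∀ p ∈ T.polys X k, ∀ y ∈ T.lower, y * p ∈ T.product X := by
  induction k with
  | zero =>
    intro p hp y hy
    have := Submodule.mul_mem_mul (Submodule.mul_mem_mul (Submodule.mul_mem_mul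
      (show (1 : R) ∈ Subalgebra.toSubmodule T.upper from T.upper.one_mem)
      (show y ∈ Subalgebra.toSubmodule T.lower from hy)) hp)
      (show (1 : R) ∈ Subalgebra.toSubmodule T.upper from T.upper.one_mem)
    rwa [one_mul, mul_one] at this
  | succ k ih =>
    intro p hp
    refine T.polys_succ_induction
      (motive := fun p => ∀ y ∈ T.lower, y * p ∈ T.product X) ih ?_ ?_ hp
    · intro i p hp y hy
      -- `y` is a derivative: `y hᵢ = [eᵢ, y'] - m` with `y'` and `m` in the lower subalgebra.
      obtain ⟨y', hy', -, hm⟩ := T.lower_le_derivs i hy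
      obtain ⟨q, hq, hpq⟩ := T.e_mul_polys X i k p hp
      have h1 := T.upper_mul_mem_product (ih p hp y' hy') (T.e_mem_upper i)
      have h2 := T.mul_upper_mem_product (ih q hq y' hy') (T.e_mem_upper i)
      have h3 := ih p hp _ hm
      convert sub_mem (sub_mem h1 h2) h3 using 1
      rw [mul_assoc y', ← hpq]
      noncomm_ring
    · exact fun p q hp hq y hy => by rw [mul_add]; exact add_mem (hp y hy) (hq y hy)

/-- The triangular decomposition of an algebra generated by a triple. -/
theorem lower_mul_torus_mul_upper
    (hgen : Algebra.adjoin F (Set.range T.h ∪ Set.range T.e ∪ Set.range T.f) = ⊤) :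
    Subalgebra.toSubmodule T.lower * Subalgebra.toSubmodule (T.torus Set.univ) *
      Subalgebra.toSubmodule T.upper = ⊤ := by
  set N := Subalgebra.toSubmodule T.lower * Subalgebra.toSubmodule (T.torus Set.univ) *
      Subalgebra.toSubmodule T.upper with hN
  have hmem : ∀ y ∈ T.lower, ∀ p ∈ T.torus Set.univ, ∀ r ∈ T.upper, y * p * r ∈ N :=
    fun y hy p hp r hr => Submodule.mul_mem_mul (Submodule.mul_mem_mul hy hp) hr
  have hind : ∀ a : R, (∀ y ∈ T.lower, ∀ p ∈ T.torus Set.univ, ∀ r ∈ T.upper,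
      a * (y * p * r) ∈ N) → ∀ n ∈ N, a * n ∈ N := by
    intro a ha n hn
    induction hn using Submodule.mul_induction_on' with
    | mem_mul_mem u hu r hr =>
      induction hu using Submodule.mul_induction_on' with
      | mem_mul_mem y hy p hp => exact ha y hy p hp r hr
      | add x _ y _ hx hy => rw [add_mul, mul_add]; exact add_mem hx hy
    | add x _ y _ hx hy => rw [mul_add]; exact add_mem hx hy
  rw [eq_top_iff, ← Algebra.top_toSubmodule, ← hgen]
  apply Submodule.adjoin_le_of_mul_mem
  · simpa using hmem 1 (one_mem _) 1 (one_mem _) 1 (one_mem _)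
  · rintro a ((⟨x, rfl⟩ | ⟨i, rfl⟩) | ⟨i, rfl⟩) <;> apply hind <;> intro y hy p hp r hr
    · convert add_mem (hmem y hy _ (mul_mem (T.h_mem_torus (Set.mem_univ x)) hp) r hr)
        (hmem _ (T.h_mul_lower x hy) p hp r hr) using 1
      noncomm_ring
    · obtain ⟨z, -, hz, hm⟩ := T.exists_isDeriv i hy
      obtain ⟨q, hq, hpq⟩ := T.e_mul_torus i hp
      convert add_mem (add_mem (hmem y hy q hq _ (mul_mem (T.e_mem_upper i) hr))
        (hmem z hz _ (mul_mem (T.h_mem_torus (Set.mem_univ (D.coroot i))) hp) r hr))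
        (hmem _ hm p hp r hr) using 1
      rw [mul_assoc y q, ← mul_assoc q, ← hpq]
      noncomm_ring
    · rw [← mul_assoc, ← mul_assoc]
      exact hmem _ (mul_mem (T.f_mem_lower i) hy) p hp r hr

/-- An algebra generated by a triple is `U₊ U₋ U(X) U₊` as soon as `X` and the coroots
span `H`. -/
theorem product_eq_top [CharZero F]
    (hgen : Algebra.adjoin F (Set.range T.h ∪ Set.range T.e ∪ Set.range T.f) = ⊤) {X : Set H}
    (hX : Submodule.span F X ⊔ Submodule.span F (Set.range D.coroot) = ⊤) :
    T.product X = ⊤ := by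
  rw [eq_top_iff, ← T.lower_mul_torus_mul_upper hgen, Submodule.mul_le]
  intro a ha r hr
  refine T.mul_upper_mem_product ?_ hr
  induction ha using Submodule.mul_induction_on' with
  | mem_mul_mem y hy p hp =>
    obtain ⟨k, hk⟩ := (Submodule.mem_iSup_of_directed _ (T.polys_mono X).directed_le).1
      (T.torus_le_iSup_polys hX hp)
    exact T.lower_mul_polys_mem_product X k p hk y hy
  | add x _ y _ hx hy => exact add_mem hx hy

end CartanData.Triple

/-! ### Factorization of enveloping algebras -/

section Env

attribute [local instance 100] LieRing.ofAssociativeRing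

variable {F L : Type*} [Field F] [LieRing L] [LieAlgebra F L]

theorem UniversalEnvelopingAlgebra.adjoin_range_ι :
    Algebra.adjoin F (Set.range (UniversalEnvelopingAlgebra.ι F (L := L))) = ⊤ := by
  set S := Algebra.adjoin F (Set.range (UniversalEnvelopingAlgebra.ι F (L := L)))
  let j : L →ₗ⁅F⁆ S :=
    { (UniversalEnvelopingAlgebra.ι F (L := L)).toLinearMap.codRestrict (Subalgebra.toSubmodule S)
        (fun x => Algebra.subset_adjoin ⟨x, rfl⟩) with
      map_lie' := fun {x y} => by
        apply Subtype.ext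
        change UniversalEnvelopingAlgebra.ι F ⁅x, y⁆ = _
        rw [LieHom.map_lie]
        rfl }
  have key : S.val.comp (UniversalEnvelopingAlgebra.lift F j) = AlgHom.id F _ := by
    apply UniversalEnvelopingAlgebra.hom_ext
    ext x
    change ((UniversalEnvelopingAlgebra.lift F j (UniversalEnvelopingAlgebra.ι F x) : S) : _) =
      UniversalEnvelopingAlgebra.ι F x
    rw [UniversalEnvelopingAlgebra.lift_ι_apply]
    rfl
  rw [eq_top_iff]
  intro u _
  have := DFunLike.congr_fun key u
  rw [AlgHom.comp_apply, AlgHom.id_apply] at this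
  rw [← this]
  exact (UniversalEnvelopingAlgebra.lift F j u).2

/-- The enveloping algebra is generated by any set that generates the Lie algebra. -/
theorem UniversalEnvelopingAlgebra.adjoin_image_ι {s : Set L}
    (hs : LieSubalgebra.lieSpan F L s = ⊤) :
    Algebra.adjoin F (UniversalEnvelopingAlgebra.ι F '' s) = ⊤ := by
  set S := Algebra.adjoin F (UniversalEnvelopingAlgebra.ι F '' s)
  let N : LieSubalgebra F L :=
    { (Subalgebra.toSubmodule S).comap (UniversalEnvelopingAlgebra.ι F (L := L)).toLinearMap with
      lie_mem' := by
        intro x y hx hy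
        change UniversalEnvelopingAlgebra.ι F ⁅x, y⁆ ∈ S
        rw [LieHom.map_lie, LieRing.of_associative_ring_bracket]
        exact sub_mem (mul_mem hx hy) (mul_mem hy hx) }
  have hN : N = ⊤ := by
    rw [eq_top_iff, ← hs, LieSubalgebra.lieSpan_le]
    exact fun x hx => Algebra.subset_adjoin ⟨x, hx, rfl⟩
  rw [eq_top_iff, ← UniversalEnvelopingAlgebra.adjoin_range_ι, Algebra.adjoin_le_iff]
  rintro _ ⟨x, rfl⟩
  have : x ∈ N := hN ▸ LieSubalgebra.mem_top x
  exact this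

theorem LieSubalgebra.adjoin_le_env (S : LieSubalgebra F L) {s : Set L} (hs : s ⊆ S) :
    Subalgebra.toSubmodule (Algebra.adjoin F (UniversalEnvelopingAlgebra.ι F '' s)) ≤ S.env := by
  rw [LieSubalgebra.env, Subalgebra.toSubmodule.le_iff_le, Algebra.adjoin_le_iff]
  rintro _ ⟨x, hx, rfl⟩
  exact ⟨UniversalEnvelopingAlgebra.ι F ⟨x, hs hx⟩, by simp⟩

theorem LieSubalgebra.env_mul_env (S : LieSubalgebra F L) : S.env * S.env = S.env :=
  (Subalgebra.isIdempotentElem_toSubmodule _).eq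

end Env

namespace CartanData

variable {ι K : Type*} [Field K] {A : Matrix ι ι K} {F H : Type*} [Field F] [Algebra K F]
  [AddCommGroup H] [Module F H] {D : CartanData A F H}
  {L : Type*} [LieRing L] [LieAlgebra F L]

/-- If a triple generates `L`, if `P` contains the `eᵢ` and `M` the `fᵢ`, and if `C` contains the
images of sufficiently many elements of `H`, then `U(L) = U(P) U(M) U(C) U(P)`. -/
theorem Triple.env_mul_eq_top [CharZero F] (T : D.Triple L)
    (hgen : LieSubalgebra.lieSpan F L (Set.range T.h ∪ Set.range T.e ∪ Set.range T.f) = ⊤)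
    {X : Set H} (hX : Submodule.span F X ⊔ Submodule.span F (Set.range D.coroot) = ⊤)
    {P M C : LieSubalgebra F L} (hP : ∀ i, T.e i ∈ P) (hM : ∀ i, T.f i ∈ M)
    (hC : ∀ x ∈ X, T.h x ∈ C) :
    P.env * M.env * C.env * P.env = ⊤ := by
  let _ : LieRing (UniversalEnvelopingAlgebra F L) := LieRing.ofAssociativeRing
  let U := T.map (UniversalEnvelopingAlgebra.ι F)
  have hU : Algebra.adjoin F (Set.range U.h ∪ Set.range U.e ∪ Set.range U.f) = ⊤ := by
    rw [← UniversalEnvelopingAlgebra.adjoin_image_ι hgen, Set.image_union, Set.image_union,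
      ← Set.range_comp, ← Set.range_comp, ← Set.range_comp]
    rfl
  have hPe : Subalgebra.toSubmodule U.upper ≤ P.env := by
    convert P.adjoin_le_env (s := Set.range T.e) (by rintro _ ⟨i, rfl⟩; exact hP i)
    rw [← Set.range_comp]; rfl
  have hMe : Subalgebra.toSubmodule U.lower ≤ M.env := by
    convert M.adjoin_le_env (s := Set.range T.f) (by rintro _ ⟨i, rfl⟩; exact hM i)
    rw [← Set.range_comp]; rfl
  have hCe : Subalgebra.toSubmodule (U.torus X) ≤ C.env := by
    convert C.adjoin_le_env (s := T.h '' X) (by rintro _ ⟨x, hx, rfl⟩; exact hC x hx)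
    rw [← Set.image_comp]; rfl
  rw [eq_top_iff, ← U.product_eq_top hU hX]
  exact mul_le_mul' (mul_le_mul' (mul_le_mul' hPe hMe) hCe) hPe

variable (D) (τ : LieIdeal F D.Pre)

/-- The generators of `g`. -/
def algTriple : D.Triple (D.Alg τ) := D.preTriple.map τ.proj

@[simp] theorem algTriple_h (x : H) : (D.algTriple τ).h x = D.h τ x := rfl

theorem algTriple_generates : LieSubalgebra.lieSpan F (D.Alg τ) (Set.range (D.algTriple τ).h ∪
    Set.range (D.algTriple τ).e ∪ Set.range (D.algTriple τ).f) = ⊤ := by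
  set S := LieSubalgebra.lieSpan F (D.Alg τ) (Set.range (D.algTriple τ).h ∪
    Set.range (D.algTriple τ).e ∪ Set.range (D.algTriple τ).f) with hS
  rw [eq_top_iff]
  intro x _
  obtain ⟨x, rfl⟩ := τ.proj_surjective x
  exact D.pre_generated (S.comap τ.proj)
    (fun x => LieSubalgebra.subset_lieSpan (Or.inl (Or.inl ⟨x, rfl⟩)))
    (fun i => LieSubalgebra.subset_lieSpan (Or.inl (Or.inr ⟨i, rfl⟩)))
    (fun i => LieSubalgebra.subset_lieSpan (Or.inr ⟨i, rfl⟩)) x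

theorem e_mem_plus (i : ι) : D.e τ i ∈ D.plus τ := LieSubalgebra.subset_lieSpan ⟨i, rfl⟩

theorem f_mem_minus (i : ι) : D.f τ i ∈ D.minus τ := LieSubalgebra.subset_lieSpan ⟨i, rfl⟩

theorem plus_minus_factorization [CharZero F] {X : Set H}
    (hX : Submodule.span F X ⊔ Submodule.span F (Set.range D.coroot) = ⊤)
    {C : LieSubalgebra F (D.Alg τ)} (hC : ∀ x ∈ X, D.h τ x ∈ C) :
    (D.plus τ).env * (D.minus τ).env * C.env * (D.plus τ).env = ⊤ :=
  (D.algTriple τ).env_mul_eq_top (D.algTriple_generates τ) hX (D.e_mem_plus τ) (D.f_mem_minus τ) hC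

theorem minus_plus_factorization [CharZero F] {X : Set H}
    (hX : Submodule.span F X ⊔ Submodule.span F (Set.range D.coroot) = ⊤)
    {C : LieSubalgebra F (D.Alg τ)} (hC : ∀ x ∈ X, D.h τ x ∈ C) :
    (D.minus τ).env * (D.plus τ).env * C.env * (D.minus τ).env = ⊤ := by
  refine (D.algTriple τ).swap.env_mul_eq_top ?_ hX (D.f_mem_minus τ) (D.e_mem_plus τ)
    (fun x hx => neg_mem (hC x hx))
  rw [eq_top_iff, ← D.algTriple_generates τ, LieSubalgebra.lieSpan_le]
  rintro _ ((⟨x, rfl⟩ | ⟨i, rfl⟩) | ⟨i, rfl⟩)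
  · exact LieSubalgebra.subset_lieSpan (Or.inl (Or.inl ⟨-x, by
      rw [Triple.swap_h, LinearMap.neg_apply, map_neg, neg_neg]⟩))
  · exact LieSubalgebra.subset_lieSpan (Or.inr ⟨i, rfl⟩)
  · exact LieSubalgebra.subset_lieSpan (Or.inl (Or.inr ⟨i, rfl⟩))

end CartanData

/-! ### Gradings by the eigenvalues `2ⁿ` of an endomorphism -/

namespace LieHom

variable {F L : Type*} [Field F] [LieRing L] [LieAlgebra F L] (φ : L →ₗ⁅F⁆ L)

/-- The eigenspace of `φ` for the eigenvalue `2ⁿ`. When `φ` multiplies the generators `eᵢ`, `fᵢ`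
and `h` by `2`, `1/2` and `1`, this is the component of height `n`. -/
def gr (n : ℤ) : Submodule F L := Module.End.eigenspace (φ : L →ₗ[F] L) ((2 : F) ^ n)

/-- The sum of the components whose degree lies in a given set. -/
def grOn (s : Set ℤ) : Submodule F L := ⨆ n ∈ s, φ.gr n

variable {φ}

theorem mem_gr {n : ℤ} {x : L} : x ∈ φ.gr n ↔ φ x = (2 : F) ^ n • x :=
  Module.End.mem_eigenspace_iff

theorem gr_le_grOn {n : ℤ} {s : Set ℤ} (hn : n ∈ s) : φ.gr n ≤ φ.grOn s :=
  le_biSup φ.gr hn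

theorem grOn_mono {s t : Set ℤ} (h : s ⊆ t) : φ.grOn s ≤ φ.grOn t :=
  biSup_mono h

theorem grOn_induction {s : Set ℤ} {motive : L → Prop} (mem : ∀ n ∈ s, ∀ x ∈ φ.gr n, motive x)
    (zero : motive 0) (add : ∀ x y, motive x → motive y → motive (x + y)) {x : L}
    (hx : x ∈ φ.grOn s) : motive x := by
  rw [grOn, iSup_subtype'] at hx
  exact Submodule.iSup_induction _ (motive := motive) hx (fun n x hx => mem n n.2 x hx) zero add

variable [CharZero F]

theorem lie_mem_gr {m n : ℤ} {x y : L} (hx : x ∈ φ.gr m) (hy : y ∈ φ.gr n) :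
    ⁅x, y⁆ ∈ φ.gr (m + n) := by
  rw [mem_gr] at *
  rw [LieHom.map_lie, hx, hy, smul_lie, lie_smul, smul_smul, zpow_add₀ two_ne_zero]

theorem lie_mem_grOn {s t u : Set ℤ} (h : ∀ m ∈ s, ∀ n ∈ t, m + n ∈ u) {x y : L}
    (hx : x ∈ φ.grOn s) (hy : y ∈ φ.grOn t) : ⁅x, y⁆ ∈ φ.grOn u := by
  refine grOn_induction (motive := fun x => ⁅x, y⁆ ∈ φ.grOn u) (fun m hm x hx => ?_) (by simp)
    (fun a b ha hb => by rw [add_lie]; exact add_mem ha hb) hx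
  refine grOn_induction (motive := fun y => ⁅x, y⁆ ∈ φ.grOn u) (fun n hn y hy => ?_) (by simp)
    (fun a b ha hb => by rw [lie_add]; exact add_mem ha hb) hy
  exact gr_le_grOn (h m hm n hn) (lie_mem_gr hx hy)

variable (F) in
/-- Different heights belong to different eigenvalues. -/
theorem two_zpow_injective : Function.Injective fun n : ℤ => (2 : F) ^ n := by
  intro m n h
  have h' : (((2 : ℚ) ^ m : ℚ) : F) = ((2 : ℚ) ^ n : ℚ) := by push_cast; exact h
  exact zpow_right_injective₀ (by norm_num) (by norm_num) (Rat.cast_injective h')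

variable (φ) in
theorem gr_iSupIndep : iSupIndep φ.gr :=
  (Module.End.eigenspaces_iSupIndep (φ : L →ₗ[F] L)).comp (two_zpow_injective F)

variable (φ) in
theorem disjoint_grOn {s t : Set ℤ} (h : Disjoint s t) : Disjoint (φ.grOn s) (φ.grOn t) :=
  φ.gr_iSupIndep.disjoint_biSup_biSup h

variable (φ) in
theorem disjoint_gr_grOn {n : ℤ} {s : Set ℤ} (h : n ∉ s) : Disjoint (φ.gr n) (φ.grOn s) :=
  φ.gr_iSupIndep.disjoint_biSup h

/-- A Lie subalgebra generated in degrees from an additively closed set lives in those degrees. -/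
theorem lieSpan_le_grOn {s : Set ℤ} (hs : ∀ m ∈ s, ∀ n ∈ s, m + n ∈ s) {X : Set L}
    (hX : X ⊆ φ.grOn s) : (LieSubalgebra.lieSpan F L X).toSubmodule ≤ φ.grOn s := by
  let S : LieSubalgebra F L :=
    { φ.grOn s with lie_mem' := fun hx hy => lie_mem_grOn hs hx hy }
  exact (LieSubalgebra.lieSpan_le (K := S)).2 hX

end LieHom

namespace CartanData

variable {ι K : Type*} [Field K] {A : Matrix ι ι K} {F H : Type*} [Field F] [Algebra K F]
  [AddCommGroup H] [Module F H]

/-! ### The homogeneous components of `g̃` -/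

namespace Triple

variable {D : CartanData A F H} {L : Type*} [LieRing L] [LieAlgebra F L] (T : D.Triple L)

/-- `T.LowerWord β x`: `x` is a right-nested bracket of degree `β` in the `fᵢ`. -/
inductive LowerWord : (ι →₀ ℤ) → L → Prop
  | f (j : ι) : LowerWord (-Finsupp.single j 1) (T.f j)
  | lie (i : ι) {β : ι →₀ ℤ} {x : L} (hx : LowerWord β x) :
      LowerWord (-Finsupp.single i 1 + β) ⁅T.f i, x⁆

/-- The span of the right-nested brackets of degree `β` in the `fᵢ`, together with the image of `H`
if `β = 0`. -/
def lowerPart (β : ι →₀ ℤ) : Submodule F L :=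
  Submodule.span F {x | T.LowerWord β x ∨ β = 0 ∧ x ∈ Set.range T.h}

/-- The span of the elements of degree `β` among the elements of `H` and the right-nested brackets
in the `eᵢ` and in the `fᵢ`. -/
def component (β : ι →₀ ℤ) : Submodule F L := T.lowerPart β ⊔ T.swap.lowerPart (-β)

variable {T}

theorem LowerWord.degree_neg {β : ι →₀ ℤ} {x : L} (h : T.LowerWord β x) :
    Finsupp.degree β < 0 := by
  induction h with
  | f j => simp
  | lie i _ ih => rw [map_add, map_neg, Finsupp.degree_single]; omega

theorem LowerWord.mem {β : ι →₀ ℤ} {x : L} (h : T.LowerWord β x) : x ∈ T.lowerPart β :=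
  Submodule.subset_span (Or.inl h)

variable (T) in
theorem h_mem_lowerPart (x : H) : T.h x ∈ T.lowerPart 0 :=
  Submodule.subset_span (Or.inr ⟨rfl, x, rfl⟩)

theorem LowerWord.h_lie {β : ι →₀ ℤ} {x : L} (hx : T.LowerWord β x) (y : H) :
    ∃ c : F, ⁅T.h y, x⁆ = c • x := by
  induction hx with
  | f j => exact ⟨-D.root j y, by rw [T.hf, neg_smul]⟩
  | @lie i β x _ ih =>
    obtain ⟨c, hc⟩ := ih
    exact ⟨-D.root i y + c, by rw [leibniz_lie, T.hf, hc, neg_lie, smul_lie, lie_smul]; module⟩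

theorem h_lie_lowerPart (y : H) {β : ι →₀ ℤ} {x : L} (hx : x ∈ T.lowerPart β) :
    ⁅T.h y, x⁆ ∈ T.lowerPart β := by
  refine LieAlgebra.lie_mem_of_mem_span F ?_ hx
  rintro x (hx | ⟨rfl, z, rfl⟩)
  · obtain ⟨c, hc⟩ := hx.h_lie y
    rw [hc]
    exact Submodule.smul_mem _ c hx.mem
  · rw [T.hh]; exact zero_mem _

theorem f_lie_lowerPart (i : ι) {β : ι →₀ ℤ} {x : L} (hx : x ∈ T.lowerPart β) :
    ⁅T.f i, x⁆ ∈ T.lowerPart (-Finsupp.single i 1 + β) := by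
  refine LieAlgebra.lie_mem_of_mem_span F ?_ hx
  rintro x (hx | ⟨rfl, z, rfl⟩)
  · exact (hx.lie i).mem
  · rw [← lie_skew, T.hf, neg_neg, add_zero]
    exact Submodule.smul_mem _ _ (LowerWord.f i).mem

theorem LowerWord.e_lie (i : ι) {β : ι →₀ ℤ} {x : L} (hx : T.LowerWord β x) :
    ⁅T.e i, x⁆ ∈ T.lowerPart (Finsupp.single i 1 + β) := by
  induction hx with
  | f j =>
    by_cases hij : i = j
    · subst hij
      rw [T.ef_same, add_neg_cancel]
      exact T.h_mem_lowerPart _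
    · rw [T.ef_ne i j hij]; exact zero_mem _
  | @lie j β x hx ih =>
    rw [leibniz_lie]
    refine add_mem ?_ (by rw [add_left_comm]; exact f_lie_lowerPart j ih)
    by_cases hij : i = j
    · subst hij
      rw [T.ef_same, add_neg_cancel_left]
      exact h_lie_lowerPart _ hx.mem
    · rw [T.ef_ne i j hij, zero_lie]; exact zero_mem _

theorem swap_swap : T.swap.swap = T := by
  simp only [swap, neg_neg]

theorem component_swap (β : ι →₀ ℤ) : T.swap.component (-β) = T.component β := by
  rw [component, component, swap_swap, neg_neg, sup_comm]

variable (T) in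
theorem h_mem_component (x : H) : T.h x ∈ T.component 0 :=
  le_sup_left (a := T.lowerPart 0) (T.h_mem_lowerPart x)

variable (T) in
theorem f_mem_component (i : ι) : T.f i ∈ T.component (-Finsupp.single i 1) :=
  le_sup_left (a := T.lowerPart _) (LowerWord.f i).mem

variable (T) in
theorem e_mem_component (i : ι) : T.e i ∈ T.component (Finsupp.single i 1) := by
  rw [← component_swap]
  exact T.swap.f_mem_component i

theorem h_lie_component (y : H) {β : ι →₀ ℤ} {x : L} (hx : x ∈ T.component β) :
    ⁅T.h y, x⁆ ∈ T.component β := by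
  obtain ⟨a, ha, b, hb, rfl⟩ := Submodule.mem_sup.1 hx
  rw [lie_add]
  refine Submodule.add_mem_sup (h_lie_lowerPart y ha) ?_
  have := h_lie_lowerPart (T := T.swap) (-y) hb
  rwa [swap_h, LinearMap.neg_apply, map_neg, neg_neg] at this

theorem e_lie_component (i : ι) {β : ι →₀ ℤ} {x : L} (hx : x ∈ T.component β) :
    ⁅T.e i, x⁆ ∈ T.component (Finsupp.single i 1 + β) := by
  obtain ⟨a, ha, b, hb, rfl⟩ := Submodule.mem_sup.1 hx
  rw [lie_add]
  refine add_mem ?_ ?_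
  · refine LieAlgebra.lie_mem_of_mem_span F ?_ ha
    rintro x (hx | ⟨rfl, z, rfl⟩)
    · exact le_sup_left (a := T.lowerPart _) (hx.e_lie i)
    · rw [← lie_skew, T.he, add_zero]
      exact neg_mem (Submodule.smul_mem _ _ (T.e_mem_component i))
  · have := f_lie_lowerPart (T := T.swap) i hb
    rw [← neg_add] at this
    exact le_sup_right (a := T.lowerPart _) this

theorem f_lie_component (i : ι) {β : ι →₀ ℤ} {x : L} (hx : x ∈ T.component β) :
    ⁅T.f i, x⁆ ∈ T.component (-Finsupp.single i 1 + β) := by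
  rw [← component_swap] at hx ⊢
  have := e_lie_component (T := T.swap) i hx
  rwa [neg_add, neg_neg]

theorem lowerPart_eq_bot {β : ι →₀ ℤ} (hβ : β ≠ 0) (hd : 0 ≤ Finsupp.degree β) :
    T.lowerPart β = ⊥ := by
  rw [lowerPart, Submodule.span_eq_bot]
  rintro x (hx | ⟨h, _⟩)
  · exact absurd hx.degree_neg hd.not_gt
  · exact absurd h hβ

/-- There are components of nonzero degree and height zero, such as `αᵢ - αⱼ`. They vanish, since
words involve only `eᵢ` or only `fᵢ`. -/
theorem component_eq_bot {β : ι →₀ ℤ} (hβ : β ≠ 0) (hd : Finsupp.degree β = 0) :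
    T.component β = ⊥ := by
  rw [component, lowerPart_eq_bot hβ hd.ge,
    lowerPart_eq_bot (neg_ne_zero.2 hβ) (by rw [map_neg, hd, neg_zero]), sup_idem]

theorem lowerPart_zero_le : T.lowerPart 0 ≤ LinearMap.range T.h := by
  refine Submodule.span_le.2 ?_
  rintro x (hx | ⟨-, y, rfl⟩)
  · exact absurd hx.degree_neg (by simp)
  · exact ⟨y, rfl⟩

theorem component_zero_le : T.component 0 ≤ LinearMap.range T.h := by
  refine sup_le lowerPart_zero_le ?_
  rw [neg_zero]
  refine lowerPart_zero_le.trans ?_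
  rintro _ ⟨y, rfl⟩
  exact ⟨-y, by simp⟩

end Triple

variable (D : CartanData A F H)

/-- Arbitrary monomials act on the components by their degrees, by the Jacobi identity. Applied to
the outermost bracket, this rewrites every monomial through nested ones. -/
theorem IsMonomial.lie_component {β γ : ι →₀ ℤ} {x y : D.Pre} (hx : D.IsMonomial β x)
    (hy : y ∈ D.preTriple.component γ) : ⁅x, y⁆ ∈ D.preTriple.component (β + γ) := by
  induction hx generalizing γ y with
  | h x => rw [zero_add]; exact Triple.h_lie_component x hy
  | e i => exact Triple.e_lie_component i hy
  | f i => rw [Finsupp.single_neg]; exact Triple.f_lie_component i hy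
  | @lie β β' a b _ _ iha ihb =>
    rw [lie_lie]
    refine sub_mem ?_ ?_
    · rw [add_assoc]; exact iha (ihb hy)
    · rw [add_comm β, add_assoc]; exact ihb (iha hy)

theorem IsMonomial.mem_component {β : ι →₀ ℤ} {x : D.Pre} (hx : D.IsMonomial β x) :
    x ∈ D.preTriple.component β := by
  induction hx with
  | h x => exact D.preTriple.h_mem_component x
  | e i => exact D.preTriple.e_mem_component i
  | f i => rw [Finsupp.single_neg]; exact D.preTriple.f_mem_component i
  | lie ha _ _ ihb => exact ha.lie_component D ihb

theorem piece_le_component (β : ι →₀ ℤ) : D.piece β ≤ D.preTriple.component β :=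
  Submodule.span_le.2 fun _ hx => hx.mem_component D

/-- The degree `0` component of `g̃` is the image of `H`. -/
theorem exists_eq_h_of_mem_piece_zero {x : D.Pre} (hx : x ∈ D.piece 0) :
    ∃ y, D.gen (Gen.h y) = x :=
  Triple.component_zero_le (D.piece_le_component 0 hx)

/-- The endomorphism of `g̃` with `h ↦ h`, `eᵢ ↦ c eᵢ` and `fᵢ ↦ c⁻¹ fᵢ`. -/
def scaling (c : F) (hc : c ≠ 0) : D.Pre →ₗ⁅F⁆ D.Pre := (D.preTriple.scale c hc).lift

/-- The endomorphism of `g̃` with `h ↦ -h`, `eᵢ ↦ fᵢ` and `fᵢ ↦ eᵢ`. -/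
def flip : D.Pre →ₗ⁅F⁆ D.Pre := D.preTriple.swap.lift

section Scaling

variable (c : F) (hc : c ≠ 0)

@[simp] theorem scaling_h (x : H) : D.scaling c hc (D.gen (Gen.h x)) = D.gen (Gen.h x) :=
  Triple.lift_h _ _

@[simp] theorem scaling_e (i : ι) : D.scaling c hc (D.gen (Gen.e i)) = c • D.gen (Gen.e i) :=
  Triple.lift_e _ _

@[simp] theorem scaling_f (i : ι) : D.scaling c hc (D.gen (Gen.f i)) = c⁻¹ • D.gen (Gen.f i) :=
  Triple.lift_f _ _

@[simp] theorem flip_h (x : H) : D.flip (D.gen (Gen.h x)) = -D.gen (Gen.h x) :=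
  Triple.lift_h _ _

@[simp] theorem flip_e (i : ι) : D.flip (D.gen (Gen.e i)) = D.gen (Gen.f i) :=
  Triple.lift_e _ _

@[simp] theorem flip_f (i : ι) : D.flip (D.gen (Gen.f i)) = D.gen (Gen.e i) :=
  Triple.lift_f _ _

theorem flip_flip (x : D.Pre) : D.flip (D.flip x) = x := by
  have : D.flip.comp D.flip = LieHom.id := by
    apply pre_hom_ext <;> intro x <;> rw [LieHom.comp_apply] <;> simp
  exact LieHom.congr_fun this x

theorem IsMonomial.scaling {β : ι →₀ ℤ} {x : D.Pre} (hx : D.IsMonomial β x) :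
    D.scaling c hc x = c ^ Finsupp.degree β • x := by
  induction hx with
  | h x => simp
  | e i => simp
  | f i => simp
  | lie _ _ iha ihb =>
    rw [LieHom.map_lie, iha, ihb, smul_lie, lie_smul, smul_smul, map_add, zpow_add₀ hc]

theorem scaling_of_mem_piece {β : ι →₀ ℤ} {x : D.Pre} (hx : x ∈ D.piece β) :
    D.scaling c hc x = c ^ Finsupp.degree β • x := by
  have : D.piece β ≤ Module.End.eigenspace (D.scaling c hc : D.Pre →ₗ[F] D.Pre)
      (c ^ Finsupp.degree β) :=
    Submodule.span_le.2 fun x hx => Module.End.mem_eigenspace_iff.2 (hx.scaling D c hc)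
  exact Module.End.mem_eigenspace_iff.1 (this hx)

theorem flip_mem_piece {β : ι →₀ ℤ} {x : D.Pre} (hx : x ∈ D.piece β) :
    D.flip x ∈ D.piece (-β) := by
  have : D.piece β ≤ (D.piece (-β)).comap (D.flip : D.Pre →ₗ[F] D.Pre) := by
    refine Submodule.span_le.2 fun x hx => ?_
    have key : D.IsMonomial (-β) (D.flip x) ∨ D.IsMonomial (-β) (-D.flip x) := by
      replace hx : D.IsMonomial β x := hx
      clear * - hx
      induction hx with
      | h x => right; simpa using IsMonomial.h x
      | e i => left; simpa [← Finsupp.single_neg] using IsMonomial.f (D := D) i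
      | f i => left; simpa [← Finsupp.single_neg] using IsMonomial.e (D := D) i
      | lie _ _ iha ihb =>
        rw [LieHom.map_lie, neg_add]
        rcases iha with ha | ha <;> rcases ihb with hb | hb
        · exact Or.inl (ha.lie hb)
        · right; rw [← lie_neg]; exact ha.lie hb
        · right; rw [← neg_lie]; exact ha.lie hb
        · left
          have := ha.lie hb
          rwa [neg_lie, lie_neg, neg_neg] at this
    change D.flip x ∈ D.piece (-β)
    rcases key with hx | hx
    · exact Submodule.subset_span hx
    · exact neg_mem_iff.1 (show -D.flip x ∈ D.piece (-β) from Submodule.subset_span hx)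
  exact this hx

end Scaling

end CartanData

namespace CartanData

/-! ### The Serre elements -/

variable {ι K : Type*} [Field K] {A : Matrix ι ι K} {F H : Type*} [Field F] [Algebra K F]
  [AddCommGroup H] [Module F H]

namespace Triple

variable {D : CartanData A F H} {L : Type*} [LieRing L] [LieAlgebra F L] (T : D.Triple L)

/-- The Serre elements in the `fᵢ`. -/
inductive IsSerre : L → Prop
  | pow (i j : ι) (n : ℕ) (hij : i ≠ j) (hi : A i i = 2) (hn : A i j = -(n : K)) :
      IsSerre ((LieAlgebra.ad F L (T.f i) ^ (n + 1)) (T.f j))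
  | comm (i j : ι) (hij : A i j = 0) : IsSerre ⁅T.f i, T.f j⁆

variable {T}

theorem ad_f_pow_succ (i : ι) (n : ℕ) (x : L) :
    (LieAlgebra.ad F L (T.f i) ^ (n + 1)) x = ⁅T.f i, (LieAlgebra.ad F L (T.f i) ^ n) x⁆ := by
  rw [pow_succ', Module.End.mul_apply, LieAlgebra.ad_apply]

theorem h_lie_ad_f_pow (y : H) (i j : ι) (n : ℕ) :
    ⁅T.h y, (LieAlgebra.ad F L (T.f i) ^ n) (T.f j)⁆ =
      (-(n * D.root i y + D.root j y)) • (LieAlgebra.ad F L (T.f i) ^ n) (T.f j) := by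
  induction n with
  | zero => simp [T.hf]
  | succ n ih =>
    rw [ad_f_pow_succ, leibniz_lie, ih, T.hf, neg_lie, smul_lie, lie_smul, Nat.cast_succ]
    module

theorem e_lie_ad_f_pow_of_ne {i k : ι} (hki : k ≠ i) (n : ℕ) (x : L) :
    ⁅T.e k, (LieAlgebra.ad F L (T.f i) ^ n) x⁆ = (LieAlgebra.ad F L (T.f i) ^ n) ⁅T.e k, x⁆ := by
  induction n with
  | zero => simp
  | succ n ih => rw [ad_f_pow_succ, ad_f_pow_succ, leibniz_lie, T.ef_ne k i hki, zero_lie, zero_add,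
      ih]

/-- The `sl₂` computation behind the Serre relations. -/
theorem e_lie_ad_f_pow_succ {i j : ι} (hij : i ≠ j) (hi : A i i = 2) (n : ℕ) :
    ⁅T.e i, (LieAlgebra.ad F L (T.f i) ^ (n + 1)) (T.f j)⁆ =
      (-((n + 1) * (n + algebraMap K F (A i j)))) •
        (LieAlgebra.ad F L (T.f i) ^ n) (T.f j) := by
  induction n with
  | zero =>
    rw [ad_f_pow_succ, leibniz_lie, T.ef_same]
    simp [T.hf, T.ef_ne i j hij, D.root_coroot]
  | succ n ih =>
    rw [ad_f_pow_succ, leibniz_lie, T.ef_same, h_lie_ad_f_pow, ih, D.root_coroot, D.root_coroot, hi,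
      lie_smul, ← ad_f_pow_succ, ← add_smul, map_ofNat, Nat.cast_succ]
    congr 1
    ring

theorem f_lie_h_coroot (i j : ι) :
    ⁅T.f i, T.h (D.coroot j)⁆ = algebraMap K F (A j i) • T.f i := by
  rw [← lie_skew, T.hf, neg_neg, D.root_coroot]

theorem IsSerre.e_lie [LinearOrder K] (hA : IsBorcherdsMatrix A) {x : L} (hx : T.IsSerre x)
    (k : ι) : ⁅T.e k, x⁆ = 0 := by
  cases hx with
  | pow i j n hij hi hn =>
    by_cases hki : k = i
    · subst hki
      rw [e_lie_ad_f_pow_succ hij hi, hn]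
      simp
    · rw [e_lie_ad_f_pow_of_ne hki]
      by_cases hkj : k = j
      · subst hkj
        rw [T.ef_same, pow_succ, Module.End.mul_apply, LieAlgebra.ad_apply, f_lie_h_coroot]
        cases n with
        | zero => rw [hA.zero_symm i k (by simpa using hn)]; simp
        | succ n =>
          rw [map_smul, pow_succ, Module.End.mul_apply, LieAlgebra.ad_apply, lie_self]
          simp
      · rw [T.ef_ne k j hkj, map_zero]
  | comm i j hij =>
    have h1 : ⁅⁅T.e k, T.f i⁆, T.f j⁆ = 0 := by
      by_cases hki : k = i
      · subst hki
        rw [T.ef_same, T.hf, D.root_coroot, hij]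
        simp
      · rw [T.ef_ne k i hki, zero_lie]
    have h2 : ⁅T.f i, ⁅T.e k, T.f j⁆⁆ = 0 := by
      by_cases hkj : k = j
      · subst hkj
        rw [T.ef_same, f_lie_h_coroot, hA.zero_symm i k hij]
        simp
      · rw [T.ef_ne k j hkj, lie_zero]
    rw [leibniz_lie, h1, h2, add_zero]

theorem IsSerre.h_lie {x : L} (hx : T.IsSerre x) (y : H) : ∃ c : F, ⁅T.h y, x⁆ = c • x := by
  cases hx with
  | pow i j n hij hi hn => exact ⟨_, h_lie_ad_f_pow y i j (n + 1)⟩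
  | comm i j hij =>
    have := h_lie_ad_f_pow (T := T) y i j 1
    rw [pow_one, LieAlgebra.ad_apply] at this
    exact ⟨_, this⟩

variable (T) in
/-- The elements obtained from Serre elements in the `fᵢ` by repeatedly applying some `ad fᵢ`. -/
inductive SerreDescendant : L → Prop
  | base {x : L} (hx : T.IsSerre x) : SerreDescendant x
  | lie (i : ι) {x : L} (hx : SerreDescendant x) : SerreDescendant ⁅T.f i, x⁆

theorem SerreDescendant.h_lie {x : L} (hx : T.SerreDescendant x) (y : H) :
    ∃ c : F, ⁅T.h y, x⁆ = c • x := by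
  induction hx with
  | base hx => exact hx.h_lie y
  | @lie i x _ ih =>
    obtain ⟨c, hc⟩ := ih
    exact ⟨-D.root i y + c, by rw [leibniz_lie, T.hf, hc, neg_lie, smul_lie, lie_smul]; module⟩

variable (T) in
/-- The ideal of the lower half generated by its Serre elements. As these are killed by all
`ad eᵢ`, it is stable under the whole algebra. -/
def serreSpan : Submodule F L := Submodule.span F {x | T.SerreDescendant x}

theorem h_lie_serreSpan (y : H) {x : L} (hx : x ∈ T.serreSpan) : ⁅T.h y, x⁆ ∈ T.serreSpan := by
  refine LieAlgebra.lie_mem_of_mem_span F (fun x hx => ?_) hx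
  obtain ⟨c, hc⟩ := SerreDescendant.h_lie hx y
  rw [hc]
  exact Submodule.smul_mem _ c (Submodule.subset_span hx)

theorem f_lie_serreSpan (i : ι) {x : L} (hx : x ∈ T.serreSpan) : ⁅T.f i, x⁆ ∈ T.serreSpan :=
  LieAlgebra.lie_mem_of_mem_span F
    (fun _ hx => Submodule.subset_span (SerreDescendant.lie i hx)) hx

theorem e_lie_serreSpan [LinearOrder K] (hA : IsBorcherdsMatrix A) (i : ι) {x : L}
    (hx : x ∈ T.serreSpan) : ⁅T.e i, x⁆ ∈ T.serreSpan := by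
  refine LieAlgebra.lie_mem_of_mem_span F (fun x hx => ?_) hx
  replace hx : T.SerreDescendant x := hx
  induction hx with
  | base hx => rw [hx.e_lie hA]; exact zero_mem _
  | @lie j x hx ih =>
    rw [leibniz_lie]
    refine add_mem ?_ (f_lie_serreSpan j ih)
    by_cases hij : i = j
    · subst hij
      rw [T.ef_same]
      exact h_lie_serreSpan _ (Submodule.subset_span hx)
    · rw [T.ef_ne i j hij, zero_lie]; exact zero_mem _

theorem serreSpan_le_grOn [CharZero F] {φ : L →ₗ⁅F⁆ L} {s : Set ℤ}
    (hs : ∀ m ∈ s, ∀ n ∈ s, m + n ∈ s) (hf : ∀ i, T.f i ∈ φ.grOn s) : T.serreSpan ≤ φ.grOn s := by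
  have hpow : ∀ i j n, (LieAlgebra.ad F L (T.f i) ^ n) (T.f j) ∈ φ.grOn s := by
    intro i j n
    induction n with
    | zero => exact hf j
    | succ n ih => rw [ad_f_pow_succ]; exact LieHom.lie_mem_grOn hs (hf i) ih
  refine Submodule.span_le.2 fun x hx => ?_
  replace hx : T.SerreDescendant x := hx
  induction hx with
  | base hx =>
    cases hx with
    | pow i j n hij hi hn => exact hpow i j (n + 1)
    | comm i j hij => exact LieHom.lie_mem_grOn hs (hf i) (hf j)
  | lie i hx ih => exact LieHom.lie_mem_grOn hs (hf i) ih

end Triple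

/-! ### The defining ideals are graded and avoid `H` -/

variable (D : CartanData A F H)

theorem lie_mem_of_generators {N : Submodule F D.Pre}
    (hh : ∀ x, ∀ n ∈ N, ⁅D.gen (Gen.h x), n⁆ ∈ N) (he : ∀ i, ∀ n ∈ N, ⁅D.gen (Gen.e i), n⁆ ∈ N)
    (hf : ∀ i, ∀ n ∈ N, ⁅D.gen (Gen.f i), n⁆ ∈ N) (x : D.Pre) {n : D.Pre} (hn : n ∈ N) :
    ⁅x, n⁆ ∈ N := by
  let S : LieSubalgebra F D.Pre :=
    { carrier := {x | ∀ n ∈ N, ⁅x, n⁆ ∈ N}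
      add_mem' := fun {a b} ha hb n hn => by rw [add_lie]; exact add_mem (ha n hn) (hb n hn)
      zero_mem' := fun n _ => by rw [zero_lie]; exact zero_mem _
      smul_mem' := fun c a ha n hn => by rw [smul_lie]; exact N.smul_mem c (ha n hn)
      lie_mem' := fun {a b} ha hb n hn => by
        rw [lie_lie]; exact sub_mem (ha _ (hb n hn)) (hb _ (ha n hn)) }
  exact D.pre_generated S hh he hf x n hn

/-- The sum of the ideals of the two halves generated by their Serre elements is an ideal
of `g̃`. -/
theorem serreIdeal_le_sup [LinearOrder K] (hA : IsBorcherdsMatrix A) :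
    D.serreIdeal.toSubmodule ≤ D.preTriple.serreSpan ⊔ D.preTriple.swap.serreSpan := by
  set N := D.preTriple.serreSpan ⊔ D.preTriple.swap.serreSpan with hN
  have key : ∀ a : D.Pre, (∀ x ∈ D.preTriple.serreSpan, ⁅a, x⁆ ∈ D.preTriple.serreSpan) →
      (∀ x ∈ D.preTriple.swap.serreSpan, ⁅a, x⁆ ∈ D.preTriple.swap.serreSpan) →
      ∀ n ∈ N, ⁅a, n⁆ ∈ N := by
    exact fun a h1 h2 n hn => LieAlgebra.lie_mem_sup h1 h2 hn
  let I : LieIdeal F D.Pre :=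
    { N with
      lie_mem := fun {x n} hn => D.lie_mem_of_generators
        (fun x => key _ (fun _ => Triple.h_lie_serreSpan x) (fun z hz => by
          have := Triple.h_lie_serreSpan (-x) hz
          rwa [Triple.swap_h, LinearMap.neg_apply, map_neg, neg_neg] at this))
        (fun i => key _ (fun _ => Triple.e_lie_serreSpan hA i) (fun _ => Triple.f_lie_serreSpan i))
        (fun i => key _ (fun _ => Triple.f_lie_serreSpan i) (fun _ => Triple.e_lie_serreSpan hA i))
        x hn }
  have hI : D.serreIdeal ≤ I := by
    refine LieSubmodule.lieSpan_le.2 fun x hx => ?_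
    change x ∈ N
    cases (hx : D.SerreRel x) with
    | e i j n hij hi hn =>
      exact le_sup_right (a := D.preTriple.serreSpan)
        (Submodule.subset_span (.base (.pow i j n hij hi hn)))
    | f i j n hij hi hn =>
      exact le_sup_left (a := D.preTriple.serreSpan)
        (Submodule.subset_span (.base (.pow i j n hij hi hn)))
    | ee i j hij =>
      exact le_sup_right (a := D.preTriple.serreSpan)
        (Submodule.subset_span (.base (.comm i j hij)))
    | ff i j hij =>
      exact le_sup_left (a := D.preTriple.serreSpan)
        (Submodule.subset_span (.base (.comm i j hij)))
  exact hI

theorem IsGradedIdeal.scaling_mem {I : LieIdeal F D.Pre} (hI : D.IsGradedIdeal I) {c : F}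
    (hc : c ≠ 0) {x : D.Pre} (hx : x ∈ I) : D.scaling c hc x ∈ I := by
  have : I.toSubmodule ≤ I.toSubmodule.comap (D.scaling c hc : D.Pre →ₗ[F] D.Pre) := by
    refine hI.trans (iSup_le fun β x hx => ?_)
    change D.scaling c hc x ∈ I
    rw [D.scaling_of_mem_piece c hc hx.2]
    exact I.smul_mem _ hx.1
  exact this hx

theorem serreRel_scaling {c : F} (hc : c ≠ 0) {x : D.Pre} (hx : D.SerreRel x) :
    ∃ d : F, D.scaling c hc x = d • x := by
  cases hx with
  | e i j n _ _ _ =>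
    refine ⟨c ^ (n + 1) * c, ?_⟩
    rw [LieHom.map_ad_pow, scaling_e, scaling_e, LieAlgebra.ad_smul_pow_smul]
  | f i j n _ _ _ =>
    refine ⟨c⁻¹ ^ (n + 1) * c⁻¹, ?_⟩
    rw [LieHom.map_ad_pow, scaling_f, scaling_f, LieAlgebra.ad_smul_pow_smul]
  | ee i j _ => exact ⟨c * c, by rw [LieHom.map_lie, scaling_e, scaling_e, smul_lie, lie_smul,
      smul_smul]⟩
  | ff i j _ => exact ⟨c⁻¹ * c⁻¹, by rw [LieHom.map_lie, scaling_f, scaling_f, smul_lie, lie_smul,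
      smul_smul]⟩

theorem IsDefiningIdeal.scaling_mem {τ : LieIdeal F D.Pre} (hτ : D.IsDefiningIdeal τ) {c : F}
    (hc : c ≠ 0) {x : D.Pre} (hx : x ∈ τ) : D.scaling c hc x ∈ τ := by
  suffices τ ≤ τ.comap (D.scaling c hc) from this hx
  rcases hτ with rfl | rfl
  · exact sSup_le fun I hI y hy => (le_sSup hI : I ≤ D.radical) (hI.1.scaling_mem D hc hy)
  · refine LieSubmodule.lieSpan_le.2 fun y hy => ?_
    obtain ⟨d, hd⟩ := D.serreRel_scaling hc hy
    change D.scaling c hc y ∈ D.serreIdeal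
    rw [hd]
    exact D.serreIdeal.smul_mem d (LieSubmodule.subset_lieSpan hy)

theorem serreRel_flip {x : D.Pre} (hx : D.SerreRel x) : D.SerreRel (D.flip x) := by
  cases hx with
  | e i j n hij hi hn =>
    rw [LieHom.map_ad_pow, flip_e, flip_e]; exact SerreRel.f i j n hij hi hn
  | f i j n hij hi hn =>
    rw [LieHom.map_ad_pow, flip_f, flip_f]; exact SerreRel.e i j n hij hi hn
  | ee i j hij => rw [LieHom.map_lie, flip_e, flip_e]; exact SerreRel.ff i j hij
  | ff i j hij => rw [LieHom.map_lie, flip_f, flip_f]; exact SerreRel.ee i j hij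

/-- The preimage under `flip` of a graded ideal is graded, as `flip` is an involution that sends
degree `β` to degree `-β`. -/
theorem IsGradedIdeal.comap_flip {I : LieIdeal F D.Pre} (hI : D.IsGradedIdeal I) :
    D.IsGradedIdeal (I.comap D.flip) := by
  intro y hy
  have hle : I.toSubmodule ≤
      (⨆ β : ι →₀ ℤ, (I.comap D.flip).toSubmodule ⊓ D.piece β).comap
        (D.flip : D.Pre →ₗ[F] D.Pre) := by
    refine hI.trans (iSup_le fun β x hx => ?_)
    refine Submodule.mem_iSup_of_mem (-β) ⟨?_, D.flip_mem_piece hx.2⟩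
    change D.flip (D.flip x) ∈ I
    rw [D.flip_flip]
    exact hx.1
  have := hle (show D.flip y ∈ I.toSubmodule from hy)
  rwa [Submodule.mem_comap, LieHom.coe_toLinearMap, D.flip_flip] at this

theorem IsDefiningIdeal.flip_mem {τ : LieIdeal F D.Pre} (hτ : D.IsDefiningIdeal τ)
    {x : D.Pre} (hx : x ∈ τ) : D.flip x ∈ τ := by
  suffices τ ≤ τ.comap D.flip from this hx
  rcases hτ with rfl | rfl
  · refine sSup_le fun I hI y hy => ?_
    have hmem : I.comap D.flip ≤ D.radical := by
      refine le_sSup ⟨hI.1.comap_flip D, fun z hz => ?_⟩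
      have hz' : D.flip (D.gen (Gen.h z)) ∈ I := hz
      rw [flip_h] at hz'
      exact hI.2 z (neg_mem_iff.1 hz')
    refine hmem (?_ : D.flip (D.flip y) ∈ I)
    rwa [D.flip_flip]
  · exact LieSubmodule.lieSpan_le.2 fun y hy => LieSubmodule.subset_lieSpan (D.serreRel_flip hy)

variable [CharZero F]

/-- The endomorphism of `g̃` whose eigenspaces define the grading by height. -/
def double : D.Pre →ₗ⁅F⁆ D.Pre := D.scaling 2 two_ne_zero

theorem h_mem_gr (x : H) : D.gen (Gen.h x) ∈ D.double.gr 0 :=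
  LieHom.mem_gr.2 (by simp [double])

theorem e_mem_gr (i : ι) : D.gen (Gen.e i) ∈ D.double.gr 1 :=
  LieHom.mem_gr.2 (by simp [double])

theorem f_mem_gr (i : ι) : D.gen (Gen.f i) ∈ D.double.gr (-1) :=
  LieHom.mem_gr.2 (by simp [double])

theorem piece_le_gr (β : ι →₀ ℤ) : D.piece β ≤ D.double.gr (Finsupp.degree β) :=
  fun _ hx => LieHom.mem_gr.2 (D.scaling_of_mem_piece 2 two_ne_zero hx)

theorem serreIdeal_le_grOn [LinearOrder K] (hA : IsBorcherdsMatrix A) :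
    D.serreIdeal.toSubmodule ≤ D.double.grOn {0}ᶜ := by
  refine (D.serreIdeal_le_sup hA).trans (sup_le ?_ ?_)
  · refine (Triple.serreSpan_le_grOn (s := Set.Iio 0) ?_ fun i => ?_).trans
      (LieHom.grOn_mono fun n hn => ?_)
    · exact fun m hm n hn => add_neg (Set.mem_Iio.1 hm) (Set.mem_Iio.1 hn)
    · exact LieHom.gr_le_grOn (by simp) (D.f_mem_gr i)
    · exact ne_of_lt hn
  · refine (Triple.serreSpan_le_grOn (s := Set.Ioi 0) ?_ fun i => ?_).trans
      (LieHom.grOn_mono fun n hn => ?_)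
    · exact fun m hm n hn => add_pos (Set.mem_Ioi.1 hm) (Set.mem_Ioi.1 hn)
    · exact LieHom.gr_le_grOn (by simp) (D.e_mem_gr i)
    · exact ne_of_gt hn

/-- A homogeneous component of nonzero degree has nonzero height or is zero, so the degree zero
part of a graded ideal that meets `H` trivially vanishes. -/
theorem radical_le_grOn : D.radical.toSubmodule ≤ D.double.grOn {0}ᶜ := by
  rw [radical, LieSubmodule.sSup_toSubmodule_eq_iSup]
  refine iSup₂_le fun I hI => hI.1.trans (iSup_le fun β => ?_)
  by_cases hβ : β = 0
  · subst hβ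
    rintro x ⟨hxI, hx⟩
    obtain ⟨y, rfl⟩ := D.exists_eq_h_of_mem_piece_zero hx
    rw [hI.2 y hxI]
    exact zero_mem _
  · refine inf_le_right.trans ?_
    by_cases hd : Finsupp.degree β = 0
    · refine (D.piece_le_component β).trans ?_
      rw [Triple.component_eq_bot hβ hd]
      exact bot_le
    · exact (D.piece_le_gr β).trans (LieHom.gr_le_grOn hd)

/-- Neither choice of `τ` has a part of height zero; hence `τ` avoids `H`. -/
theorem IsDefiningIdeal.le_grOn [LinearOrder K] (hA : IsBorcherdsMatrix A) {τ : LieIdeal F D.Pre}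
    (hτ : D.IsDefiningIdeal τ) : τ.toSubmodule ≤ D.double.grOn {0}ᶜ := by
  rcases hτ with rfl | rfl
  · exact D.radical_le_grOn
  · exact D.serreIdeal_le_grOn hA

end CartanData

namespace CartanData

/-! ### The Verma representation and the embedding of `H` -/

attribute [local instance 100] LieRing.ofAssociativeRing

variable {ι K : Type*} [Field K] {A : Matrix ι ι K} {F H : Type*} [Field F] [Algebra K F]
  [AddCommGroup H] [Module F H] (D : CartanData A F H) (wt : Module.Dual F H)

/-- The weight of the basis vector `w` of the Verma module of `g̃` with highest weight `wt`: this
module is the free associative algebra on the `fᵢ`, with basis the words `w`. -/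
def vermaWeight (w : List ι) : Module.Dual F H := wt - (w.map D.root).sum

/-- Left multiplication by `fᵢ`. -/
def vermaF (i : ι) : Module.End F (List ι →₀ F) := Finsupp.lmapDomain F F (List.cons i)

/-- The diagonal action of `H`. -/
def vermaH : H →ₗ[F] Module.End F (List ι →₀ F) where
  toFun x := Finsupp.linearCombination F fun w => Finsupp.single w (D.vermaWeight wt w x)
  map_add' x y := by
    ext w : 2
    simp [Finsupp.single_add]
  map_smul' c x := by
    ext w : 2
    simp

open Classical in
/-- The action of `eᵢ` on a basis vector, determined by `eᵢ 1 = 0` and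
`eᵢ fⱼ = fⱼ eᵢ + δᵢⱼ hᵢ`. -/
def vermaEOn (i : ι) : List ι → List ι →₀ F
  | [] => 0
  | j :: w => vermaF j (vermaEOn i w) +
      if i = j then Finsupp.single w (D.vermaWeight wt w (D.coroot i)) else 0

/-- The action of `eᵢ`. -/
def vermaE (i : ι) : Module.End F (List ι →₀ F) :=
  Finsupp.linearCombination F (D.vermaEOn wt i)

variable {D wt}

@[simp] theorem vermaF_single (i : ι) (w : List ι) (c : F) :
    vermaF i (Finsupp.single w c) = Finsupp.single (i :: w) c := by
  simp [vermaF]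

@[simp] theorem vermaH_single (x : H) (w : List ι) :
    D.vermaH wt x (Finsupp.single w 1) = D.vermaWeight wt w x • Finsupp.single w 1 := by
  simp [vermaH]

@[simp] theorem vermaE_single (i : ι) (w : List ι) :
    D.vermaE wt i (Finsupp.single w 1) = D.vermaEOn wt i w := by
  simp [vermaE]

theorem vermaWeight_cons (i : ι) (w : List ι) :
    D.vermaWeight wt (i :: w) = D.vermaWeight wt w - D.root i := by
  simp only [vermaWeight, List.map_cons, List.sum_cons]
  abel

theorem vermaH_mul_vermaF (x : H) (i : ι) :
    D.vermaH wt x * vermaF i = vermaF i * D.vermaH wt x + -(D.root i x • vermaF i) := by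
  apply Finsupp.lhom_ext'
  intro w
  apply LinearMap.ext_ring
  change D.vermaH wt x (vermaF i (Finsupp.single w 1)) =
    vermaF i (D.vermaH wt x (Finsupp.single w 1)) + -(D.root i x • vermaF i (Finsupp.single w 1))
  rw [vermaF_single, vermaH_single, vermaH_single, map_smul, vermaF_single, vermaWeight_cons,
    LinearMap.sub_apply, sub_smul, sub_eq_add_neg]

theorem vermaE_mul_vermaF_same (i : ι) :
    D.vermaE wt i * vermaF i = vermaF i * D.vermaE wt i + D.vermaH wt (D.coroot i) := by
  apply Finsupp.lhom_ext'
  intro w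
  apply LinearMap.ext_ring
  change D.vermaE wt i (vermaF i (Finsupp.single w 1)) =
    vermaF i (D.vermaE wt i (Finsupp.single w 1)) + D.vermaH wt (D.coroot i) (Finsupp.single w 1)
  rw [vermaF_single, vermaE_single, vermaE_single, vermaH_single, vermaEOn, if_pos rfl]
  simp

theorem vermaE_mul_vermaF_ne {i j : ι} (hij : i ≠ j) :
    D.vermaE wt i * vermaF j = vermaF j * D.vermaE wt i := by
  apply Finsupp.lhom_ext'
  intro w
  apply LinearMap.ext_ring
  change D.vermaE wt i (vermaF j (Finsupp.single w 1)) =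
    vermaF j (D.vermaE wt i (Finsupp.single w 1))
  rw [vermaF_single, vermaE_single, vermaE_single, vermaEOn, if_neg hij, add_zero]

theorem vermaH_vermaEOn (x : H) (i : ι) (w : List ι) :
    D.vermaH wt x (D.vermaEOn wt i w) =
      (D.vermaWeight wt w x + D.root i x) • D.vermaEOn wt i w := by
  induction w with
  | nil => simp [vermaEOn]
  | cons j w ih =>
    have hF := LinearMap.congr_fun (D.vermaH_mul_vermaF (wt := wt) x j) (D.vermaEOn wt i w)
    simp only [Module.End.mul_apply, LinearMap.add_apply, LinearMap.neg_apply,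
      LinearMap.smul_apply, ih, map_smul, ← sub_eq_add_neg] at hF
    rw [vermaEOn, map_add, hF, vermaWeight_cons, LinearMap.sub_apply, smul_add, ← sub_smul]
    congr 1
    · congr 1; ring
    · split_ifs with hij
      · subst hij
        rw [← mul_one (D.vermaWeight wt w (D.coroot i)), ← smul_eq_mul, ← Finsupp.smul_single,
          map_smul, vermaH_single, sub_add_cancel, smul_comm]
      · simp

theorem vermaH_mul_vermaE (x : H) (i : ι) :
    D.vermaH wt x * D.vermaE wt i = D.vermaE wt i * D.vermaH wt x + D.root i x • D.vermaE wt i := by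
  apply Finsupp.lhom_ext'
  intro w
  apply LinearMap.ext_ring
  change D.vermaH wt x (D.vermaE wt i (Finsupp.single w 1)) =
    D.vermaE wt i (D.vermaH wt x (Finsupp.single w 1)) +
      D.root i x • D.vermaE wt i (Finsupp.single w 1)
  rw [vermaE_single, vermaH_single, map_smul, vermaE_single, vermaH_vermaEOn, add_smul]

theorem vermaH_comm (x y : H) :
    D.vermaH wt x * D.vermaH wt y = D.vermaH wt y * D.vermaH wt x := by
  apply Finsupp.lhom_ext'
  intro w
  apply LinearMap.ext_ring
  change D.vermaH wt x (D.vermaH wt y (Finsupp.single w 1)) =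
    D.vermaH wt y (D.vermaH wt x (Finsupp.single w 1))
  rw [vermaH_single, vermaH_single, map_smul, map_smul, vermaH_single, vermaH_single, smul_comm]

variable (D wt)

/-- The Verma module as a representation of `g̃`. -/
def vermaTriple : D.Triple (Module.End F (List ι →₀ F)) where
  h := D.vermaH wt
  e := D.vermaE wt
  f := vermaF
  hh x y := by rw [LieRing.of_associative_ring_bracket, vermaH_comm, sub_self]
  he x i := sub_eq_of_eq_add' (D.vermaH_mul_vermaE x i)
  hf x i := sub_eq_of_eq_add' (D.vermaH_mul_vermaF x i)
  ef_same i := sub_eq_of_eq_add' (D.vermaE_mul_vermaF_same i)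
  ef_ne i j hij := sub_eq_zero.2 (D.vermaE_mul_vermaF_ne hij)

/-- `H` embeds into `g̃`: its elements are told apart by their action on highest weight vectors. -/
theorem gen_h_eq_zero {x : H} (hx : D.gen (Gen.h x) = 0) : x = 0 := by
  rw [← Module.forall_dual_apply_eq_zero_iff F]
  intro wt
  have h1 : D.vermaH wt x = 0 := by
    have := (D.vermaTriple wt).lift_h x
    rwa [hx, map_zero, eq_comm] at this
  have h2 := congrArg (fun v => v []) (vermaH_single (D := D) (wt := wt) x [])
  simpa [h1, vermaWeight] using h2.symm

end CartanData

namespace CartanData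

/-! ### The grading of `g` by height -/

variable {ι K : Type*} [Field K] {A : Matrix ι ι K} {F H : Type*} [Field F] [Algebra K F]
  [AddCommGroup H] [Module F H] (D : CartanData A F H) {τ : LieIdeal F D.Pre}

theorem exists_eq_h_of_mem_cartan {x : D.Alg τ} (hx : x ∈ D.cartan τ) : ∃ y, D.h τ y = x := by
  let S : LieSubalgebra F (D.Alg τ) :=
    { LinearMap.range (D.algTriple τ).h with
      lie_mem' := by
        rintro _ _ ⟨x, rfl⟩ ⟨y, rfl⟩
        exact ⟨0, by rw [(D.algTriple τ).hh, map_zero]⟩ }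
  exact (LieSubalgebra.lieSpan_le (K := S)).2 (by rintro _ ⟨y, rfl⟩; exact ⟨y, rfl⟩) hx

section CharZero

variable [CharZero F]

/-- The endomorphism of `g` whose eigenspaces define the grading by height. -/
def algDouble (hτ : D.IsDefiningIdeal τ) : D.Alg τ →ₗ⁅F⁆ D.Alg τ :=
  τ.quotientLift (τ.proj.comp D.double) fun _ hx =>
    τ.proj_eq_zero.2 (hτ.scaling_mem D two_ne_zero hx)

theorem proj_mem_gr (hτ : D.IsDefiningIdeal τ) {n : ℤ} {x : D.Pre} (hx : x ∈ D.double.gr n) :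
    τ.proj x ∈ (D.algDouble hτ).gr n := by
  rw [LieHom.mem_gr] at *
  change τ.proj (D.double x) = _
  rw [hx, map_smul]

theorem plus_le_grOn (hτ : D.IsDefiningIdeal τ) :
    (D.plus τ).toSubmodule ≤ (D.algDouble hτ).grOn (Set.Ioi 0) := by
  refine LieHom.lieSpan_le_grOn (fun m hm n hn => add_pos (Set.mem_Ioi.1 hm) (Set.mem_Ioi.1 hn)) ?_
  rintro _ ⟨i, rfl⟩
  exact LieHom.gr_le_grOn (Set.mem_Ioi.2 one_pos) (D.proj_mem_gr hτ (D.e_mem_gr i))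

theorem minus_le_grOn (hτ : D.IsDefiningIdeal τ) :
    (D.minus τ).toSubmodule ≤ (D.algDouble hτ).grOn (Set.Iio 0) := by
  refine LieHom.lieSpan_le_grOn (fun m hm n hn => add_neg (Set.mem_Iio.1 hm) (Set.mem_Iio.1 hn)) ?_
  rintro _ ⟨i, rfl⟩
  exact LieHom.gr_le_grOn (Set.mem_Iio.2 neg_one_lt_zero) (D.proj_mem_gr hτ (D.f_mem_gr i))

theorem plus_inf_minus (hτ : D.IsDefiningIdeal τ) : D.plus τ ⊓ D.minus τ = ⊥ := by
  rw [eq_bot_iff]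
  rintro x ⟨hp, hm⟩
  have := (D.algDouble hτ).disjoint_grOn (s := Set.Ioi 0) (t := Set.Iio 0)
    (Set.disjoint_left.2 fun n hn hn' => lt_asymm (Set.mem_Ioi.1 hn) (Set.mem_Iio.1 hn'))
  exact (Submodule.disjoint_def.1 this) x (D.plus_le_grOn hτ hp) (D.minus_le_grOn hτ hm)

theorem h_eq_zero_of_mem_plus_sup_minus (hτ : D.IsDefiningIdeal τ) {x : H}
    (hx : D.h τ x ∈ (D.plus τ).toSubmodule ⊔ (D.minus τ).toSubmodule) : D.h τ x = 0 := by
  have hle : (D.plus τ).toSubmodule ⊔ (D.minus τ).toSubmodule ≤ (D.algDouble hτ).grOn {0}ᶜ :=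
    sup_le ((D.plus_le_grOn hτ).trans (LieHom.grOn_mono fun n hn => ne_of_gt hn))
      ((D.minus_le_grOn hτ).trans (LieHom.grOn_mono fun n hn => ne_of_lt hn))
  exact Submodule.disjoint_def.1 ((D.algDouble hτ).disjoint_gr_grOn (by simp)) _
    (D.proj_mem_gr hτ (D.h_mem_gr x)) (hle hx)

variable [LinearOrder K]

/-- `H` embeds into `g`. -/
theorem eq_zero_of_h_eq_zero (hτ : D.IsDefiningIdeal τ) (hA : IsBorcherdsMatrix A) {x : H}
    (hx : D.h τ x = 0) : x = 0 := by
  apply D.gen_h_eq_zero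
  exact Submodule.disjoint_def.1 (D.double.disjoint_gr_grOn (by simp)) _ (D.h_mem_gr x)
    (hτ.le_grOn D hA (τ.proj_eq_zero.1 hx))

end CharZero

/-! ### The derived algebra meets `H` in the span of the coroots -/

attribute [local instance 100] LieRing.ofAssociativeRing

/-- The triple in the abelian Lie algebra `F` given by a linear form on `H` that vanishes on the
coroots. -/
def functionalTriple (wt : Module.Dual F H) (hwt : ∀ i, wt (D.coroot i) = 0) : D.Triple F where
  h := wt
  e _ := 0
  f _ := 0
  hh x y := by rw [LieRing.of_associative_ring_bracket, mul_comm, sub_self]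
  he x i := by simp
  hf x i := by simp
  ef_same i := by simp [hwt]
  ef_ne i j _ := by simp

/-- The homomorphism to `F` is invariant under `double`, so it vanishes in nonzero heights. -/
theorem functionalTriple_lift_eq_zero [CharZero F] (wt : Module.Dual F H)
    (hwt : ∀ i, wt (D.coroot i) = 0) {x : D.Pre} (hx : x ∈ D.double.grOn {0}ᶜ) :
    (D.functionalTriple wt hwt).lift x = 0 := by
  set ψ := (D.functionalTriple wt hwt).lift
  have key : ψ.comp D.double = ψ := by
    apply pre_hom_ext <;> intro x <;> rw [LieHom.comp_apply] <;>
      simp [double, ψ, functionalTriple]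
  refine LieHom.grOn_induction (motive := fun x => ψ x = 0) (fun n hn x hx => ?_) (map_zero _)
    (fun x y hx hy => by rw [map_add, hx, hy, add_zero]) hx
  have h1 := LieHom.congr_fun key x
  rw [LieHom.comp_apply, LieHom.mem_gr.1 hx, map_smul, smul_eq_mul] at h1
  by_contra h0
  have h2 : (2 : F) ^ n = 2 ^ (0 : ℤ) := by rw [zpow_zero]; exact mul_eq_right₀ h0 |>.1 h1
  exact hn (LieHom.two_zpow_injective F h2)

theorem mem_span_coroot_of_h_mem_derived [CharZero F] [LinearOrder K] (hτ : D.IsDefiningIdeal τ)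
    (hA : IsBorcherdsMatrix A) {x : H} (hx : D.h τ x ∈ D.derived τ) :
    x ∈ Submodule.span F (Set.range D.coroot) := by
  by_contra hxs
  obtain ⟨wt, hne, hle⟩ := Submodule.exists_le_ker_of_notMem hxs
  have hwt : ∀ i, wt (D.coroot i) = 0 := fun i => hle (Submodule.subset_span ⟨i, rfl⟩)
  let ψ : D.Alg τ →ₗ⁅F⁆ F := τ.quotientLift (D.functionalTriple wt hwt).lift fun y hy =>
    D.functionalTriple_lift_eq_zero wt hwt (hτ.le_grOn D hA hy)
  have hd : D.derived τ ≤ ψ.ker := by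
    refine (LieSubmodule.lie_le_iff _ _ _).2 fun a _ b _ => ?_
    rw [LieHom.mem_ker, LieHom.map_lie, LieRing.of_associative_ring_bracket, mul_comm, sub_self]
  have h0 : ψ (D.h τ x) = 0 := LieHom.mem_ker.1 (hd hx)
  exact hne (((D.functionalTriple wt hwt).lift_h x).symm.trans h0)

/-- The elements of `H` with image in a complement `h''` span `H` together with the coroots. -/
theorem IsComplement.span_sup_span_coroot [CharZero F] [LinearOrder K] (hτ : D.IsDefiningIdeal τ)
    (hA : IsBorcherdsMatrix A)
    {h'' : LieSubalgebra F (D.Alg τ)} (hh'' : D.IsComplement τ h'') :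
    Submodule.span F {x | D.h τ x ∈ h''} ⊔ Submodule.span F (Set.range D.coroot) = ⊤ := by
  rw [eq_top_iff]
  intro x _
  have hx : D.h τ x ∈ (D.cartan τ).toSubmodule := LieSubalgebra.subset_lieSpan ⟨x, rfl⟩
  rw [← hh''.sup_eq] at hx
  obtain ⟨a, ha, b, ⟨hb, hbd⟩, hab⟩ := Submodule.mem_sup.1 hx
  have hac : a ∈ (D.cartan τ).toSubmodule := by
    rw [← hh''.sup_eq]
    exact le_sup_left (a := h''.toSubmodule) ha
  obtain ⟨y, rfl⟩ := D.exists_eq_h_of_mem_cartan hac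
  obtain ⟨z, rfl⟩ := D.exists_eq_h_of_mem_cartan hb
  have hxyz : x - (y + z) = 0 := by
    apply D.eq_zero_of_h_eq_zero hτ hA
    rw [← algTriple_h, map_sub, map_add, algTriple_h, algTriple_h, algTriple_h, hab, sub_self]
  rw [sub_eq_zero.1 hxyz]
  exact Submodule.add_mem_sup (Submodule.subset_span ha)
    (D.mem_span_coroot_of_h_mem_derived hτ hA hbd)

/-! ### The Chevalley involution -/

/-- The Chevalley involution of `g̃`. -/
def preChevalley : D.Pre →ₗ⁅F⁆ D.Pre := D.flip.comp (D.scaling (-1) (neg_ne_zero.2 one_ne_zero))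

@[simp] theorem preChevalley_h (x : H) :
    D.preChevalley (D.gen (Gen.h x)) = -D.gen (Gen.h x) := by
  rw [preChevalley, LieHom.comp_apply, scaling_h, flip_h]

@[simp] theorem preChevalley_e (i : ι) :
    D.preChevalley (D.gen (Gen.e i)) = -D.gen (Gen.f i) := by
  rw [preChevalley, LieHom.comp_apply, scaling_e, map_smul, flip_e, neg_one_smul]

@[simp] theorem preChevalley_f (i : ι) :
    D.preChevalley (D.gen (Gen.f i)) = -D.gen (Gen.e i) := by
  rw [preChevalley, LieHom.comp_apply, scaling_f, map_smul, flip_f, inv_neg_one, neg_one_smul]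

theorem preChevalley_preChevalley (x : D.Pre) : D.preChevalley (D.preChevalley x) = x := by
  have : D.preChevalley.comp D.preChevalley = LieHom.id := by
    apply pre_hom_ext <;> intro x <;> rw [LieHom.comp_apply] <;> simp
  exact LieHom.congr_fun this x

/-- The Chevalley involution of `g` as a homomorphism. -/
def chevalleyHom (hτ : D.IsDefiningIdeal τ) : D.Alg τ →ₗ⁅F⁆ D.Alg τ :=
  τ.quotientLift (τ.proj.comp D.preChevalley) fun _ hx =>
    τ.proj_eq_zero.2 (hτ.flip_mem D (hτ.scaling_mem D _ hx))

theorem chevalleyHom_proj (hτ : D.IsDefiningIdeal τ) (x : D.Pre) :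
    D.chevalleyHom hτ (τ.proj x) = τ.proj (D.preChevalley x) := rfl

theorem chevalleyHom_chevalleyHom (hτ : D.IsDefiningIdeal τ) (x : D.Alg τ) :
    D.chevalleyHom hτ (D.chevalleyHom hτ x) = x := by
  obtain ⟨x, rfl⟩ := τ.proj_surjective x
  rw [chevalleyHom_proj, chevalleyHom_proj, preChevalley_preChevalley]

/-- The Chevalley involution of `g`. -/
def chevalley (hτ : D.IsDefiningIdeal τ) : D.Alg τ ≃ₗ⁅F⁆ D.Alg τ :=
  { D.chevalleyHom hτ with
    invFun := D.chevalleyHom hτ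
    left_inv := D.chevalleyHom_chevalleyHom hτ
    right_inv := D.chevalleyHom_chevalleyHom hτ }

theorem chevalley_proj (hτ : D.IsDefiningIdeal τ) (x : D.Pre) :
    D.chevalley hτ (τ.proj x) = τ.proj (D.preChevalley x) := rfl

theorem chevalley_chevalley (hτ : D.IsDefiningIdeal τ) (x : D.Alg τ) :
    D.chevalley hτ (D.chevalley hτ x) = x :=
  D.chevalleyHom_chevalleyHom hτ x

theorem isChevalleyInvolution_chevalley (hτ : D.IsDefiningIdeal τ) :
    D.IsChevalleyInvolution τ (D.chevalley hτ) where
  map_e i := (D.chevalley_proj hτ _).trans (by rw [preChevalley_e, map_neg]; rfl)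
  map_f i := (D.chevalley_proj hτ _).trans (by rw [preChevalley_f, map_neg]; rfl)
  map_h x := (D.chevalley_proj hτ _).trans (by rw [preChevalley_h, map_neg]; rfl)

theorem map_chevalley_plus (hτ : D.IsDefiningIdeal τ) :
    (D.plus τ).map (D.chevalley hτ : D.Alg τ →ₗ⁅F⁆ D.Alg τ) = D.minus τ := by
  have hω := D.isChevalleyInvolution_chevalley hτ
  apply le_antisymm
  · rw [LieSubalgebra.map_le_iff_le_comap, plus, LieSubalgebra.lieSpan_le]
    rintro _ ⟨i, rfl⟩
    change D.chevalley hτ (D.e τ i) ∈ D.minus τ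
    rw [hω.map_e]
    exact neg_mem (D.f_mem_minus τ i)
  · rw [minus, LieSubalgebra.lieSpan_le]
    rintro _ ⟨i, rfl⟩
    refine ⟨-D.e τ i, neg_mem (D.e_mem_plus τ i), ?_⟩
    change D.chevalley hτ (-D.e τ i) = D.f τ i
    rw [map_neg, hω.map_e, neg_neg]

end CartanData

end

theorem corollary3p2
    {K : Type*} [Field K] [LinearOrder K] [IsStrictOrderedRing K]
    {F : Type*} [Field F] [CharZero F] [Algebra K F]
    {ι : Type*} [Finite ι] {A : Matrix ι ι K} (hA : IsBorcherdsMatrix A)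
    {H : Type*} [AddCommGroup H] [Module F H] (D : CartanData A F H)
    (τ : LieIdeal F D.Pre) (hτ : D.IsDefiningIdeal τ)
    (h'' : LieSubalgebra F (D.Alg τ)) (hh'' : D.IsComplement τ h'') :
    -- the two factorizations of `U(g)`
    (D.plus τ).env * (D.minus τ).env * h''.env * (D.plus τ).env = ⊤ ∧
    (D.minus τ).env * (D.plus τ).env * h''.env * (D.minus τ).env = ⊤ ∧
    -- perfect algebras of positive rank
    (Nonempty ι → D.derived τ = ⊤ →
      -- the subalgebra `P` generated by `h''` and `g₊` is `h'' ⊕ g₊`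
      (h'' ⊔ D.plus τ).toSubmodule = h''.toSubmodule ⊔ (D.plus τ).toSubmodule ∧
      h'' ⊓ D.plus τ = ⊥ ∧
      IsPlusMinusPair (h'' ⊔ D.plus τ) (D.minus τ) ∧
      IsRegularPlusMinusPair (h'' ⊔ D.plus τ) (D.minus τ) ∧
      -- the automorphism of order two can be taken to be the Chevalley involution
      ∃ ω : D.Alg τ ≃ₗ⁅F⁆ D.Alg τ, D.IsChevalleyInvolution τ ω ∧
        (∀ x, ω (ω x) = x) ∧ (∃ x, ω x ≠ x) ∧
        (h'' ⊔ D.plus τ).map (ω : D.Alg τ →ₗ⁅F⁆ D.Alg τ) = D.minus τ) := by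
  have hX := hh''.span_sup_span_coroot D hτ hA
  refine ⟨D.plus_minus_factorization τ hX fun _ hx => hx,
    D.minus_plus_factorization τ hX fun _ hx => hx, ?_⟩
  rintro ⟨i⟩ hperf
  -- For perfect `g` all of `𝔥` lies in `[g, g]`, so its complement is zero.
  have hbot : h'' = ⊥ := by
    have hinf := hh''.inf_eq_bot
    have hsup := hh''.sup_eq
    rw [hperf, LieSubmodule.top_toSubmodule, inf_top_eq] at hinf hsup
    rw [← LieSubalgebra.toSubmodule_inj, LieSubalgebra.bot_toSubmodule, ← hinf, eq_comm,
      inf_eq_left, ← hsup]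
    exact le_sup_left
  subst hbot
  have hi : D.h τ (D.coroot i) ≠ 0 := fun h =>
    D.coroot_indep.ne_zero i (D.eq_zero_of_h_eq_zero hτ hA h)
  have hne : ∃ x, D.chevalley hτ x ≠ x := by
    refine ⟨D.h τ (D.coroot i), fun h => hi ?_⟩
    rw [(D.isChevalleyInvolution_chevalley hτ).map_h, neg_eq_iff_add_eq_zero, ← two_smul F,
      smul_eq_zero_iff_right two_ne_zero] at h
    exact h
  have hpm : IsPlusMinusPair (D.plus τ) (D.minus τ) := by
    refine ⟨fun h => hi (D.h_eq_zero_of_mem_plus_sup_minus hτ (h ▸ Submodule.mem_top)), ?_⟩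
    -- Elements of `H` with image `0` lie in every subalgebra; taking `C = g₋` merges two factors.
    have hfac := D.plus_minus_factorization τ hX (C := D.minus τ)
      fun x hx => by
        have hx0 : D.h τ x = 0 := hx
        rw [hx0]
        exact zero_mem _
    rwa [mul_assoc (D.plus τ).env, LieSubalgebra.env_mul_env] at hfac
  rw [bot_sup_eq]
  refine ⟨by simp, bot_inf_eq (D.plus τ), hpm, ⟨hpm, D.plus_inf_minus hτ, D.chevalley hτ,
    D.chevalley_chevalley hτ, hne, D.map_chevalley_plus hτ⟩, D.chevalley hτ,
    D.isChevalleyInvolution_chevalley hτ, D.chevalley_chevalley hτ, hne, D.map_chevalley_plus hτ⟩
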